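/- Let $g\in C^2(\mathbb R)$ be bounded and strictly increasing, with $g(0)=0$, strictly concave on $(0,+\infty)$ and strictly convex on $(-\infty,0)$, and let $g_\pm=\lim_{s\to\pm\infty}g(s)$. Let $p:\mathbb R\to\mathbb R$ be continuous. There is a constant $H>0$, depending only on $g$ and $p$, such that the following holds for every $T>0$ for which $p$ is $T$-periodic and $$g_-<\frac1T\int_0^T p(t)\,dt<g_+ .$$ For all $k,n\in\mathbb N$ with $k$ odd and $nT\ge H(k+1)$, the equation $$\ddot u+g(u)=p(t)$$ has an $nT$-periodic solution $u\in C^2(\mathbb R)$ which has a zero $t_0$ and exactly $k$ zeros in the open interval $(t_0,t_0+nT)$; equivalently, $u$ has exactly $k+1$ zeros in every half-open interval $[a,a+nT)$. Moreover, if $T$ is the minimal period of $p$ and $n$ and $k+1$ are coprime, then $nT$ is the minimal period of $u$. Consequently there are infinitely many subharmonic solutions: there exist integers $N_1<N_2<\cdots$ and solutions $u_j$ that are $N_jT$-periodic and whose minimal periods $\tau_j$ tend to $+\infty$; if $T$ is the minimal period of $p$, then $\tau_j=N_jT$ for every $j$. -/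

import Mathlib

/-- The standing assumption on the restoring force: `g(0) = 0`, `g` is of class `C²`, bounded,
strictly increasing on `ℝ`, strictly concave on `(0, ∞)` and strictly convex on `(-∞, 0)`. -/
structure IsSaturatingForce (g : ℝ → ℝ) : Prop where
  map_zero : g 0 = 0
  contDiff : ContDiff ℝ 2 g
  bounded : ∃ C : ℝ, ∀ s : ℝ, |g s| ≤ C
  strictMono : StrictMono g
  strictConcaveOn_pos : StrictConcaveOn ℝ (Set.Ioi 0) g
  strictConvexOn_neg : StrictConvexOn ℝ (Set.Iio 0) g

/-- `u` is a classical solution on the whole real line of `u'' + g(u) = p(t)`. -/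
def IsSolution (g p u : ℝ → ℝ) : Prop :=
  ContDiff ℝ 2 u ∧ ∀ t : ℝ, deriv (deriv u) t + g (u t) = p t

/-- `τ` is the minimal (positive) period of `f`. In particular a constant function has none. -/
def IsMinimalPeriod (f : ℝ → ℝ) (τ : ℝ) : Prop :=
  0 < τ ∧ Function.Periodic f τ ∧ ∀ σ : ℝ, 0 < σ → Function.Periodic f σ → τ ≤ σ

open Set Filter Topology MeasureTheory
open scoped NNReal Interval

/-!
Truncating the nonlinearity makes the Dirichlet problem on an interval solvable by shooting, and
comparison with a parabola shows that on a long interval there are a large positive and a large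
negative arc, on which the truncation is inactive. Concavity of the force makes such an arc unique,
so its action is a function of the end points alone; its derivative in the right (left) end point is
`-v ^ 2 / 2` (`v ^ 2 / 2`), with `v` the velocity there, and it equals `-α L ^ 3 + o(L ^ 3)` in the
length `L`, with `α` depending only on the sign of the arc.

A period `n T` is split into `k + 1` arcs of alternating sign so as to maximize the total action
subject to a lower bound on the gaps. Were one gap short, some other gap would be long, and moving
a multiple of `T` from the long one to the short one, while translating the arcs in between by
that multiple, would increase the total by the cubic asymptotics. Hence the maximum is interior,
the speeds of consecutive arcs agree at their common zero, and the arcs form a periodic solution.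
Its minimal period is a multiple of that of `p`, and coprimality of `n` and `k + 1` excludes
a proper divisor, since that would divide the number of zeros.
-/

section MeanValue

lemma continuous_of_hasDerivAt {u v : ℝ → ℝ} (h : ∀ t, HasDerivAt u (v t) t) : Continuous u :=
  continuous_iff_continuousAt.2 fun t => (h t).continuousAt

lemma abs_sub_le_of_hasDerivAt {u v : ℝ → ℝ} {s : Set ℝ} {C x y : ℝ} (hs : Convex ℝ s)
    (h : ∀ t ∈ s, HasDerivAt u (v t) t) (hC : ∀ t ∈ s, |v t| ≤ C) (hx : x ∈ s) (hy : y ∈ s) :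
    |u y - u x| ≤ C * |y - x| :=
  hs.norm_image_sub_le_of_norm_hasDerivWithin_le (fun t ht => (h t ht).hasDerivWithinAt) hC hx hy

end MeanValue

section SecondOrderODE

/-- The first-order vector field `(x, y) ↦ (y, f t x)` of the scalar equation `u'' = f t u`. -/
def phaseField (f : ℝ → ℝ → ℝ) (t : ℝ) (z : ℝ × ℝ) : ℝ × ℝ := (z.2, f t z.1)

/-- The field `phaseField f` with the velocity truncated to `[-R, R]`. It is bounded, so the
Picard–Lindelöf theorem applies to it on time intervals of any length. -/
def truncatedPhaseField (f : ℝ → ℝ → ℝ) (R t : ℝ) (z : ℝ × ℝ) : ℝ × ℝ :=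
  (max (-R) (min R z.2), f t z.1)

lemma hasDerivAt_fst_comp {α : ℝ → ℝ × ℝ} {z : ℝ × ℝ} {t : ℝ} (h : HasDerivAt α z t) :
    HasDerivAt (fun s => (α s).1) z.1 t :=
  (hasFDerivAt_fst (p := α t)).comp_hasDerivAt t h

lemma hasDerivAt_snd_comp {α : ℝ → ℝ × ℝ} {z : ℝ × ℝ} {t : ℝ} (h : HasDerivAt α z t) :
    HasDerivAt (fun s => (α s).2) z.2 t :=
  (hasFDerivAt_snd (p := α t)).comp_hasDerivAt t h

variable {f : ℝ → ℝ → ℝ} {K : ℝ≥0} {M : ℝ}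

lemma lipschitzWith_comp_fst {φ : ℝ → ℝ} (h : LipschitzWith K φ) :
    LipschitzWith K fun z : ℝ × ℝ => φ z.1 := by
  simpa only [mul_one, Function.comp_def] using h.comp (LipschitzWith.prod_fst (α := ℝ) (β := ℝ))

lemma lipschitzWith_phaseField (hl : ∀ t, LipschitzWith K (f t)) (t : ℝ) :
    LipschitzWith (max 1 K) (phaseField f t) :=
  LipschitzWith.prod_snd.prodMk (lipschitzWith_comp_fst (hl t))

lemma lipschitzWith_truncatedPhaseField (hl : ∀ t, LipschitzWith K (f t)) (R t : ℝ) :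
    LipschitzWith (max 1 K) (truncatedPhaseField f R t) :=
  ((LipschitzWith.prod_snd.const_min R).const_max (-R)).prodMk (lipschitzWith_comp_fst (hl t))

lemma norm_truncatedPhaseField_le {R t x : ℝ} {z : ℝ × ℝ} (hR : 0 ≤ R) (hx : |f t z.1| ≤ x) :
    ‖truncatedPhaseField f R t z‖ ≤ R + x := by
  have hclamp : |max (-R) (min R z.2)| ≤ R :=
    abs_le.2 ⟨le_max_left _ _, max_le (by linarith) (min_le_left _ _)⟩
  exact max_le (hclamp.trans (by linarith [(abs_nonneg _).trans hx]))
    (hx.trans (by linarith))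

lemma truncatedPhaseField_eq_phaseField {R t : ℝ} {z : ℝ × ℝ} (hz : |z.2| ≤ R) :
    truncatedPhaseField f R t z = phaseField f t z := by
  rw [abs_le] at hz
  rw [truncatedPhaseField, phaseField, min_eq_right hz.2, max_eq_right hz.1]

lemma exists_truncatedPhaseField_curve (hc : ∀ x, Continuous fun t => f t x)
    (hl : ∀ t, LipschitzWith K (f t)) (hb : ∀ t x, |f t x| ≤ M) (t₀ : ℝ) (z₀ : ℝ × ℝ)
    {R N : ℝ} (hR : 0 ≤ R) (hN : 0 ≤ N) :
    ∃ α : ℝ → ℝ × ℝ, α t₀ = z₀ ∧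
      ∀ t ∈ Ioo (t₀ - N) (t₀ + N), HasDerivAt α (truncatedPhaseField f R t (α t)) t := by
  have hM : 0 ≤ M := (abs_nonneg _).trans (hb 0 0)
  have hpl : IsPicardLindelof (truncatedPhaseField f R) (tmin := t₀ - N) (tmax := t₀ + N)
      ⟨t₀, by constructor <;> linarith⟩ z₀ ((R + M) * N).toNNReal 0 (R + M).toNNReal
      (max 1 K) := by
    refine ⟨fun t _ => (lipschitzWith_truncatedPhaseField hl R t).lipschitzOnWith,
      fun z _ => (continuous_const.prodMk (hc z.1)).continuousOn, fun t _ z _ => ?_, ?_⟩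
    · rw [Real.coe_toNNReal _ (by positivity)]
      exact norm_truncatedPhaseField_le hR (hb t z.1)
    · rw [Real.coe_toNNReal _ (by positivity), Real.coe_toNNReal _ (by positivity)]
      simp
  obtain ⟨α, hα₀, hα⟩ := hpl.exists_eq_forall_mem_Icc_hasDerivWithinAt₀
  exact ⟨α, hα₀, fun t ht =>
    (hα t (Ioo_subset_Icc_self ht)).hasDerivAt (Icc_mem_nhds ht.1 ht.2)⟩

lemma exists_phaseField_curve_Ioo (hc : ∀ x, Continuous fun t => f t x)
    (hl : ∀ t, LipschitzWith K (f t)) (hb : ∀ t x, |f t x| ≤ M) (t₀ : ℝ) (z₀ : ℝ × ℝ)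
    {N : ℝ} (hN : 0 < N) :
    ∃ α : ℝ → ℝ × ℝ, α t₀ = z₀ ∧
      ∀ t ∈ Ioo (t₀ - N) (t₀ + N), HasDerivAt α (phaseField f t (α t)) t := by
  have hM : 0 ≤ M := (abs_nonneg _).trans (hb 0 0)
  obtain ⟨α, hα₀, hα⟩ := exists_truncatedPhaseField_curve hc hl hb t₀ z₀
    (R := |z₀.2| + M * N) (by positivity) hN.le
  refine ⟨α, hα₀, fun t ht => ?_⟩
  have hvel : |(α t).2 - (α t₀).2| ≤ M * |t - t₀| :=
    abs_sub_le_of_hasDerivAt (convex_Ioo _ _) (fun s hs => hasDerivAt_snd_comp (hα s hs))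
      (fun s _ => hb s _) (by constructor <;> linarith) ht
  have htime : |t - t₀| ≤ N := abs_le.2 ⟨by linarith [ht.1], by linarith [ht.2]⟩
  have hbound : |(α t).2| ≤ |z₀.2| + M * N := by
    rw [hα₀] at hvel
    linarith [abs_sub_abs_le_abs_sub (α t).2 z₀.2, mul_le_mul_of_nonneg_left htime hM]
  exact truncatedPhaseField_eq_phaseField (f := f) hbound ▸ hα t ht

lemma phaseField_curve_eqOn_Ioo (hl : ∀ t, LipschitzWith K (f t)) {a b t₀ : ℝ}
    {α β : ℝ → ℝ × ℝ} (ht₀ : t₀ ∈ Ioo a b)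
    (hα : ∀ t ∈ Ioo a b, HasDerivAt α (phaseField f t (α t)) t)
    (hβ : ∀ t ∈ Ioo a b, HasDerivAt β (phaseField f t (β t)) t) (h₀ : α t₀ = β t₀) :
    EqOn α β (Ioo a b) :=
  ODE_solution_unique_of_mem_Ioo (v := phaseField f) (s := fun _ => univ)
    (fun t _ => (lipschitzWith_phaseField hl t).lipschitzOnWith) ht₀
    (fun t ht => ⟨hα t ht, mem_univ _⟩) (fun t ht => ⟨hβ t ht, mem_univ _⟩) h₀

theorem exists_phaseField_curve (hc : ∀ x, Continuous fun t => f t x)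
    (hl : ∀ t, LipschitzWith K (f t)) (hb : ∀ t x, |f t x| ≤ M) (t₀ : ℝ) (z₀ : ℝ × ℝ) :
    ∃ α : ℝ → ℝ × ℝ, α t₀ = z₀ ∧ ∀ t, HasDerivAt α (phaseField f t (α t)) t := by
  choose! α hα₀ hα using fun (N : ℝ) (hN : 0 < N) =>
    exists_phaseField_curve_Ioo hc hl hb t₀ z₀ hN
  have hagree : ∀ N N' t, |t - t₀| < N → N ≤ N' → α N t = α N' t := by
    intro N N' t ht hNN'
    have hN : 0 < N := (abs_nonneg _).trans_lt ht
    rw [abs_lt] at ht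
    exact phaseField_curve_eqOn_Ioo (t₀ := t₀) (a := t₀ - N) (b := t₀ + N) hl
      ⟨by linarith, by linarith⟩ (hα N hN)
      (fun s hs => hα N' (hN.trans_le hNN') s ⟨by linarith [hs.1], by linarith [hs.2]⟩)
      (by rw [hα₀ N hN, hα₀ N' (hN.trans_le hNN')]) ⟨by linarith, by linarith⟩
  refine ⟨fun t => α (|t - t₀| + 1) t, hα₀ _ (by positivity), fun t => ?_⟩
  have hnear : ∀ᶠ s in 𝓝 t, |s - t₀| < |t - t₀| + 1 :=
    (by fun_prop : Continuous fun s : ℝ => |s - t₀|).continuousAt.eventually_lt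
      continuousAt_const (by linarith)
  have ht : t ∈ Ioo (t₀ - (|t - t₀| + 1)) (t₀ + (|t - t₀| + 1)) :=
    ⟨by linarith [neg_abs_le (t - t₀)], by linarith [le_abs_self (t - t₀)]⟩
  refine (hα (|t - t₀| + 1) (by positivity) t ht).congr_of_eventuallyEq ?_
  filter_upwards [hnear] with s hs
  rcases le_total (|s - t₀| + 1) (|t - t₀| + 1) with hle | hle
  · exact hagree _ _ s (by linarith) hle
  · exact (hagree _ _ s hs hle).symm

theorem phaseField_curve_unique (hl : ∀ t, LipschitzWith K (f t)) {t₀ : ℝ} {α β : ℝ → ℝ × ℝ}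
    (hα : ∀ t, HasDerivAt α (phaseField f t (α t)) t)
    (hβ : ∀ t, HasDerivAt β (phaseField f t (β t)) t) (h₀ : α t₀ = β t₀) : α = β :=
  ODE_solution_unique_univ (v := phaseField f) (s := fun _ => univ)
    (fun t => (lipschitzWith_phaseField hl t).lipschitzOnWith)
    (fun t => ⟨hα t, mem_univ _⟩) (fun t => ⟨hβ t, mem_univ _⟩) h₀

theorem phaseField_curve_eqOn_Icc (hl : ∀ t, LipschitzWith K (f t)) {a b : ℝ} {α β : ℝ → ℝ × ℝ}
    (hα : ∀ t ∈ Icc a b, HasDerivAt α (phaseField f t (α t)) t)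
    (hβ : ∀ t ∈ Icc a b, HasDerivAt β (phaseField f t (β t)) t) (h₀ : α a = β a) :
    EqOn α β (Icc a b) :=
  ODE_solution_unique (v := phaseField f) (lipschitzWith_phaseField hl)
    (fun t ht => (hα t ht).continuousAt.continuousWithinAt)
    (fun t ht => (hα t (Ico_subset_Icc_self ht)).hasDerivWithinAt)
    (fun t ht => (hβ t ht).continuousAt.continuousWithinAt)
    (fun t ht => (hβ t (Ico_subset_Icc_self ht)).hasDerivWithinAt) h₀

theorem dist_phaseField_curve_le (hl : ∀ t, LipschitzWith K (f t)) {a t : ℝ} {α β : ℝ → ℝ × ℝ}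
    (hα : ∀ t, HasDerivAt α (phaseField f t (α t)) t)
    (hβ : ∀ t, HasDerivAt β (phaseField f t (β t)) t) (ht : a ≤ t) :
    dist (α t) (β t) ≤ dist (α a) (β a) * Real.exp ((max 1 K : ℝ≥0) * (t - a)) :=
  dist_le_of_trajectories_ODE (v := phaseField f) (lipschitzWith_phaseField hl)
    (fun t _ => (hα t).continuousAt.continuousWithinAt) (fun t _ => (hα t).hasDerivWithinAt)
    (fun t _ => (hβ t).continuousAt.continuousWithinAt) (fun t _ => (hβ t).hasDerivWithinAt)
    le_rfl t ⟨ht, le_rfl⟩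

lemma continuous_shooting (hl : ∀ t, LipschitzWith K (f t)) {a b c : ℝ} (hab : a ≤ b)
    {α : ℝ → ℝ → ℝ × ℝ} (hα₀ : ∀ x, α x a = (c, x))
    (hα : ∀ x t, HasDerivAt (α x) (phaseField f t (α x t)) t) :
    Continuous fun x => (α x b).1 := by
  refine LipschitzWith.continuous (K := (Real.exp ((max 1 K : ℝ≥0) * (b - a))).toNNReal)
    (LipschitzWith.of_dist_le_mul fun x y => ?_)
  have hdist := dist_phaseField_curve_le hl (hα x) (hα y) hab
  have hinit : dist (c, x) (c, y) = dist x y := by simp [Prod.dist_eq]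
  rw [hα₀, hα₀, hinit, mul_comm] at hdist
  rw [Real.coe_toNNReal _ (Real.exp_pos _).le]
  exact (le_max_left _ _).trans hdist

lemma abs_sub_linear_le_of_hasDerivAt {u v φ : ℝ → ℝ} {a b : ℝ} (hab : a ≤ b)
    (hu : ∀ t ∈ Icc a b, HasDerivAt u (v t) t) (hv : ∀ t ∈ Icc a b, HasDerivAt v (φ t) t)
    (hφ : ∀ t ∈ Icc a b, |φ t| ≤ M) :
    |u b - u a - v a * (b - a)| ≤ M * (b - a) ^ 2 := by
  have ha : a ∈ Icc a b := left_mem_Icc.2 hab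
  have hM : 0 ≤ M := (abs_nonneg _).trans (hφ a ha)
  have hvel : ∀ t ∈ Icc a b, |v t - v a| ≤ M * (b - a) := fun t ht => by
    refine (abs_sub_le_of_hasDerivAt (convex_Icc a b) hv hφ ha ht).trans
      (mul_le_mul_of_nonneg_left ?_ hM)
    rw [abs_of_nonneg (sub_nonneg.2 ht.1)]
    linarith [ht.2]
  have hpos := abs_sub_le_of_hasDerivAt (u := fun t => u t - v a * (t - a)) (convex_Icc a b)
    (fun t ht => ((hu t ht).sub (((hasDerivAt_id t).sub_const a).const_mul (v a))).congr_deriv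
      (by rw [mul_one])) hvel ha (right_mem_Icc.2 hab)
  rw [abs_of_nonneg (sub_nonneg.2 hab)] at hpos
  calc |u b - u a - v a * (b - a)| = |u b - v a * (b - a) - (u a - v a * (a - a))| := by
        congr 1; ring
    _ ≤ M * (b - a) ^ 2 := hpos.trans (le_of_eq (by ring))

theorem exists_dirichlet_solution (hc : ∀ x, Continuous fun t => f t x)
    (hl : ∀ t, LipschitzWith K (f t)) (hb : ∀ t x, |f t x| ≤ M) {a b : ℝ} (hab : a < b) :
    ∃ u v : ℝ → ℝ, u a = 0 ∧ u b = 0 ∧ (∀ t, HasDerivAt u (v t) t) ∧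
      ∀ t, HasDerivAt v (f t (u t)) t := by
  choose α hα₀ hα using fun x : ℝ => exists_phaseField_curve hc hl hb a (0, x)
  have hu : ∀ x t, HasDerivAt (fun s => (α x s).1) (α x t).2 t := fun x t =>
    hasDerivAt_fst_comp (hα x t)
  have hv : ∀ x t, HasDerivAt (fun s => (α x s).2) (f t (α x t).1) t := fun x t =>
    hasDerivAt_snd_comp (hα x t)
  have hend : ∀ x, |(α x b).1 - x * (b - a)| ≤ M * (b - a) ^ 2 := fun x => by
    have := abs_sub_linear_le_of_hasDerivAt hab.le (fun t _ => hu x t) (fun t _ => hv x t)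
      (fun t _ => hb t _)
    rwa [hα₀, sub_zero] at this
  have hL : 0 < b - a := sub_pos.2 hab
  obtain ⟨x, -, hx⟩ : ∃ x ∈ Icc (-(M * (b - a))) (M * (b - a)), (α x b).1 = 0 := by
    have hM : 0 ≤ M * (b - a) := mul_nonneg ((abs_nonneg _).trans (hb 0 0)) hL.le
    refine intermediate_value_Icc (by linarith)
      (continuous_shooting hl hab.le hα₀ hα).continuousOn ⟨?_, ?_⟩
    · linarith [(abs_le.1 (hend (-(M * (b - a))))).2]
    · linarith [(abs_le.1 (hend (M * (b - a)))).1]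
  exact ⟨fun t => (α x t).1, fun t => (α x t).2, by simp only [hα₀], hx, hu x, hv x⟩

end SecondOrderODE

section Green

variable {u v φ : ℝ → ℝ} {a b t : ℝ}

lemma integral_sub_mul_second_deriv (hu : ∀ s, HasDerivAt u (v s) s) (hφ : Continuous φ)
    (hv : ∀ s ∈ uIcc a t, HasDerivAt v (φ s) s) (c : ℝ) :
    ∫ s in a..t, (s - c) * φ s = ((t - c) * v t - u t) - ((a - c) * v a - u a) := by
  refine intervalIntegral.integral_eq_sub_of_hasDerivAt (f := fun s => (s - c) * v s - u s)
    (fun s hs => ?_) (Continuous.intervalIntegrable (by fun_prop) _ _)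
  exact ((((hasDerivAt_id s).sub_const c).mul (hv s hs)).sub (hu s)).congr_deriv (by simp)

lemma green_representation (hu : ∀ s, HasDerivAt u (v s) s) (hφ : Continuous φ)
    (hv : ∀ s ∈ Icc a b, HasDerivAt v (φ s) s) (ht : t ∈ Icc a b) :
    (b - a) * u t = (b - t) * u a + (t - a) * u b
      - (b - t) * (∫ s in a..t, (s - a) * φ s) - (t - a) * ∫ s in t..b, (b - s) * φ s := by
  have hleft := integral_sub_mul_second_deriv (a := a) (t := t) hu hφ
    (fun s hs => hv s (uIcc_subset_Icc ⟨le_rfl, ht.1.trans ht.2⟩ ht hs)) a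
  have hright := integral_sub_mul_second_deriv (a := t) (t := b) hu hφ
    (fun s hs => hv s (uIcc_subset_Icc ht ⟨ht.1.trans ht.2, le_rfl⟩ hs)) b
  have hflip : ∫ s in t..b, (b - s) * φ s = - ∫ s in t..b, (s - b) * φ s := by
    rw [← intervalIntegral.integral_neg]
    congr 1
    ext s
    ring
  rw [hflip, hleft, hright]
  ring

lemma abs_integral_mul_le {ω : ℝ → ℝ} {C : ℝ} (hab : a ≤ b) (hω : Continuous ω)
    (hφ : Continuous φ) (hC : ∀ s ∈ Icc a b, |ω s| ≤ C) :
    |∫ s in a..b, ω s * φ s| ≤ C * ∫ s in a..b, |φ s| := by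
  refine (intervalIntegral.abs_integral_le_integral_abs hab).trans ?_
  rw [← intervalIntegral.integral_const_mul]
  refine intervalIntegral.integral_mono_on hab (Continuous.intervalIntegrable (by fun_prop) _ _)
    (Continuous.intervalIntegrable (by fun_prop) _ _) fun s hs => ?_
  rw [abs_mul]
  exact mul_le_mul_of_nonneg_right (hC s hs) (abs_nonneg _)

lemma abs_green_le (hu : ∀ s, HasDerivAt u (v s) s) (hφ : Continuous φ)
    (hv : ∀ s ∈ Icc a b, HasDerivAt v (φ s) s) (ht : t ∈ Icc a b) (ha : u a = 0) :
    (b - a) * |u t| ≤ (t - a) * |u b| + (t - a) * (b - t) * ∫ s in a..b, |φ s| := by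
  have hta : 0 ≤ t - a := sub_nonneg.2 ht.1
  have hbt : 0 ≤ b - t := sub_nonneg.2 ht.2
  have hba : 0 ≤ b - a := by linarith
  have hleft : |∫ s in a..t, (s - a) * φ s| ≤ (t - a) * ∫ s in a..t, |φ s| :=
    abs_integral_mul_le ht.1 (by fun_prop) hφ fun s hs => by
      rw [abs_of_nonneg (sub_nonneg.2 hs.1)]; linarith [hs.2]
  have hright : |∫ s in t..b, (b - s) * φ s| ≤ (b - t) * ∫ s in t..b, |φ s| :=
    abs_integral_mul_le ht.2 (by fun_prop) hφ fun s hs => by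
      rw [abs_of_nonneg (sub_nonneg.2 hs.2)]; linarith [hs.1]
  have hadd := intervalIntegral.integral_add_adjacent_intervals (μ := volume)
    (hφ.abs.intervalIntegrable a t) (hφ.abs.intervalIntegrable t b)
  have hrep := green_representation hu hφ hv ht
  rw [ha, mul_zero, zero_add] at hrep
  calc (b - a) * |u t| = |(b - a) * u t| := by rw [abs_mul, abs_of_nonneg hba]
    _ ≤ |(t - a) * u b| + |(b - t) * ∫ s in a..t, (s - a) * φ s|
          + |(t - a) * ∫ s in t..b, (b - s) * φ s| := by
        rw [hrep]; exact (abs_sub _ _).trans (add_le_add_left (abs_sub _ _) _)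
    _ = (t - a) * |u b| + (b - t) * |∫ s in a..t, (s - a) * φ s|
          + (t - a) * |∫ s in t..b, (b - s) * φ s| := by
        rw [abs_mul, abs_mul, abs_mul, abs_of_nonneg hta, abs_of_nonneg hbt]
    _ ≤ (t - a) * |u b| + (b - t) * ((t - a) * ∫ s in a..t, |φ s|)
          + (t - a) * ((b - t) * ∫ s in t..b, |φ s|) := by gcongr
    _ = (t - a) * |u b| + (t - a) * (b - t) * ∫ s in a..b, |φ s| := by rw [← hadd]; ring

end Green

section Estimates

variable {g : ℝ → ℝ} {G M κ : ℝ}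

lemma abs_sub_mul_le_of_concaveOn (hmono : Monotone g) (hconc : ConcaveOn ℝ (Ioi 0) g)
    (hG : ∀ s, g s ≤ G) {μ x y : ℝ} (hμ : 0 ≤ μ) (hx : μ ≤ x) (hy : μ ≤ y) :
    |g x - g y| * μ ≤ 2 * (G - g (μ / 2)) * |x - y| := by
  wlog hxy : x ≤ y generalizing x y
  · rw [abs_sub_comm (g x), abs_sub_comm x]
    exact this hy hx (le_of_not_ge hxy)
  rcases hμ.eq_or_lt with rfl | hμ
  · rw [mul_zero]
    exact mul_nonneg (by linarith [hG (0 / 2)]) (abs_nonneg _)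
  rcases hxy.eq_or_lt with rfl | hxy
  · simp
  rw [abs_sub_comm (g x), abs_sub_comm x, abs_of_nonneg (sub_nonneg.2 (hmono hxy.le)),
    abs_of_pos (sub_pos.2 hxy)]
  have hsecant : (g y - g x) / (y - x) ≤ (g x - g (μ / 2)) / (x - μ / 2) :=
    hconc.slope_anti_adjacent (mem_Ioi.2 (by linarith)) (mem_Ioi.2 (by linarith))
      (by linarith) hxy
  have hsecant_le : (g x - g (μ / 2)) / (x - μ / 2) ≤ (G - g (μ / 2)) / (μ / 2) := by
    have : g (μ / 2) ≤ g x := hmono (by linarith)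
    exact div_le_div₀ (by linarith [hG x]) (by linarith [hG x]) (by linarith) (by linarith)
  have hslope := hsecant.trans hsecant_le
  rw [div_le_div_iff₀ (by linarith) (by linarith)] at hslope
  linarith

lemma hasDerivAt_integral_left {q : ℝ → ℝ} (hq : Continuous q) (t s : ℝ) :
    HasDerivAt (fun s => ∫ r in s..t, q r) (-q s) s :=
  intervalIntegral.integral_hasDerivAt_left (hq.intervalIntegrable _ _)
    hq.stronglyMeasurable.stronglyMeasurableAtFilter hq.continuousAt

lemma integral_sub_mul_eq_integral_integral {q : ℝ → ℝ} (hq : Continuous q) (a t : ℝ) :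
    ∫ s in a..t, (s - a) * q s = ∫ s in a..t, ∫ r in s..t, q r := by
  have htail := continuous_of_hasDerivAt (hasDerivAt_integral_left hq t)
  have hparts : ∫ s in a..t, ((s - a) * q s - ∫ r in s..t, q r) = 0 := by
    rw [intervalIntegral.integral_eq_sub_of_hasDerivAt
      (f := fun s => -((s - a) * ∫ r in s..t, q r)) (fun s _ => ?_)
      (Continuous.intervalIntegrable (by fun_prop) _ _)]
    · simp
    · exact (((hasDerivAt_id s).sub_const a).mul
        (hasDerivAt_integral_left hq t s)).neg.congr_deriv (by simp only [id]; ring)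
  rw [intervalIntegral.integral_sub (Continuous.intervalIntegrable (by fun_prop) _ _)
    (htail.intervalIntegrable _ _)] at hparts
  exact sub_eq_zero.1 hparts

lemma integral_sub_mul_le_of_integral_le {q : ℝ → ℝ} {a t B : ℝ} (hq : Continuous q)
    (hat : a ≤ t) (hB : ∀ s ∈ Icc a t, ∫ r in s..t, q r ≤ B) :
    ∫ s in a..t, (s - a) * q s ≤ B * (t - a) := by
  rw [integral_sub_mul_eq_integral_integral hq]
  calc ∫ s in a..t, ∫ r in s..t, q r ≤ ∫ _ in a..t, B :=
        intervalIntegral.integral_mono_on hat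
          ((continuous_of_hasDerivAt (hasDerivAt_integral_left hq t)).intervalIntegrable _ _)
          (continuous_const.intervalIntegrable _ _) hB
    _ = B * (t - a) := by rw [intervalIntegral.integral_const, smul_eq_mul, mul_comm]

/-- The parabola `κ (s - a) (b - s)`, a barrier from below for the positive arcs on `[a, b]`. -/
def parab (κ a b s : ℝ) : ℝ := κ * ((s - a) * (b - s))

@[fun_prop]
lemma continuous_parab (κ a b : ℝ) : Continuous (parab κ a b) := by
  unfold parab; fun_prop

lemma parab_nonneg {a b s : ℝ} (hκ : 0 ≤ κ) (hs : s ∈ Icc a b) : 0 ≤ parab κ a b s :=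
  mul_nonneg hκ (mul_nonneg (sub_nonneg.2 hs.1) (sub_nonneg.2 hs.2))

lemma parab_pos {a b s : ℝ} (hκ : 0 < κ) (hs : s ∈ Ioo a b) : 0 < parab κ a b s :=
  mul_pos hκ (mul_pos (sub_pos.2 hs.1) (sub_pos.2 hs.2))

/-- The total deficit `∫ (G - g)` along one half of the parabola `parab κ 0 L`. The half enters
through `abs_sub_mul_le_of_concaveOn`, which compares `g` with its value at half the level. -/
noncomputable def deficit (g : ℝ → ℝ) (G κ L : ℝ) : ℝ :=
  ∫ s in (0 : ℝ)..L, (G - g (κ / 2 * (s * (L - s))))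

lemma integral_half_parab_eq_deficit (g : ℝ → ℝ) (G κ a b : ℝ) :
    ∫ s in a..b, (G - g (parab κ a b s / 2)) = deficit g G κ (b - a) := by
  have hshift := intervalIntegral.integral_comp_sub_right (a := a) (b := b)
    (fun s => G - g (κ / 2 * (s * (b - a - s)))) a
  rw [sub_self] at hshift
  rw [deficit, ← hshift]
  congr 1
  ext s
  rw [parab]
  congr 2
  ring

lemma deficit_div_eq_integral (g : ℝ → ℝ) (G κ : ℝ) {L : ℝ} (hL : L ≠ 0) :
    deficit g G κ L / L = ∫ x in (0 : ℝ)..1, (G - g (κ / 2 * (L * x * (L - L * x)))) := by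
  rw [intervalIntegral.integral_comp_mul_left (fun s => G - g (κ / 2 * (s * (L - s)))) hL,
    deficit, mul_zero, mul_one, smul_eq_mul, div_eq_inv_mul]

lemma tendsto_half_parab_atTop (hκ : 0 < κ) {x : ℝ} (hx : x ∈ Ioo 0 1) :
    Tendsto (fun L : ℝ => κ / 2 * (L * x * (L - L * x))) atTop atTop :=
  ((tendsto_pow_atTop two_ne_zero).const_mul_atTop
    (mul_pos (half_pos hκ) (mul_pos hx.1 (sub_pos.2 hx.2)))).congr fun L => by ring

lemma tendsto_deficit_div (hg : Continuous g) (hbound : ∀ s, |g s| ≤ M)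
    (hlim : Tendsto g atTop (𝓝 G)) (hκ : 0 < κ) :
    Tendsto (fun L => deficit g G κ L / L) atTop (𝓝 0) := by
  suffices H : Tendsto (fun L => ∫ x in (0 : ℝ)..1, (G - g (κ / 2 * (L * x * (L - L * x)))))
      atTop (𝓝 (∫ _ in (0 : ℝ)..1, (0 : ℝ))) by
    rw [intervalIntegral.integral_zero] at H
    refine H.congr' ?_
    filter_upwards [eventually_ne_atTop 0] with L hL
    exact (deficit_div_eq_integral g G κ hL).symm
  refine intervalIntegral.tendsto_integral_filter_of_dominated_convergence (fun _ => |G| + M)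
    (Eventually.of_forall fun L => (by fun_prop : Continuous fun x : ℝ =>
      G - g (κ / 2 * (L * x * (L - L * x)))).aestronglyMeasurable)
    (Eventually.of_forall fun _ => Eventually.of_forall fun _ _ =>
      (abs_sub _ _).trans (add_le_add le_rfl (hbound _)))
    (intervalIntegrable_const (μ := volume)) ?_
  have hne : ∀ᵐ x : ℝ, x ≠ 1 := by simp [ae_iff, measure_singleton]
  filter_upwards [hne] with _ hx1 hx
  rw [uIoc_of_le zero_le_one] at hx
  simpa only [sub_self, Function.comp_def] using (tendsto_const_nhds (x := G)).sub
    (hlim.comp (tendsto_half_parab_atTop hκ ⟨hx.1, hx.2.lt_of_ne hx1⟩))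

/-- The interval lengths on which a positive arc lying above the parabola
`parab ((G - m) / 4) a b` exists and is unique. -/
def LongEnough (g : ℝ → ℝ) (m G B L : ℝ) : Prop :=
  0 < L ∧ 2 * B ≤ (G - m) / 8 * L ∧ deficit g G ((G - m) / 4) L ≤ (G - m) / 16 * L

end Estimates

/-- `u` is of class `C¹` with derivative `v`, and it solves `u'' + g u = p` at the points
of `s`. -/
structure IsMotionOn (g p : ℝ → ℝ) (s : Set ℝ) (u v : ℝ → ℝ) : Prop where
  deriv_fst : ∀ t, HasDerivAt u (v t) t
  cont : Continuous v
  deriv_snd : ∀ t ∈ s, HasDerivAt v (p t - g (u t)) t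

namespace IsMotionOn

variable {g p u v : ℝ → ℝ} {s s' : Set ℝ}

lemma mono (h : IsMotionOn g p s u v) (hs : s' ⊆ s) : IsMotionOn g p s' u v :=
  ⟨h.deriv_fst, h.cont, fun t ht => h.deriv_snd t (hs ht)⟩

lemma continuous_fst (h : IsMotionOn g p s u v) : Continuous u :=
  continuous_of_hasDerivAt h.deriv_fst

lemma comp_neg (h : IsMotionOn g p s u v) :
    IsMotionOn g (fun t => p (-t)) (Neg.neg ⁻¹' s) (fun t => u (-t)) (fun t => -v (-t)) where
  deriv_fst t := by
    simpa [Function.comp_def] using (h.deriv_fst (-t)).comp t (hasDerivAt_neg t)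
  cont := (h.cont.comp continuous_neg).neg
  deriv_snd t ht := by
    simpa [Function.comp_def, Pi.neg_def] using
      ((h.deriv_snd (-t) ht).comp t (hasDerivAt_neg t)).neg

lemma translate {τ : ℝ} (h : IsMotionOn g p s u v) (hp : Function.Periodic p τ) :
    IsMotionOn g p ((· - τ) ⁻¹' s) (fun t => u (t - τ)) (fun t => v (t - τ)) where
  deriv_fst t := (h.deriv_fst (t - τ)).comp_sub_const t τ
  cont := h.cont.comp (continuous_sub_right τ)
  deriv_snd t ht := by
    have hv := (h.deriv_snd (t - τ) ht).comp_sub_const t τ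
    rwa [hp.sub_eq] at hv

end IsMotionOn

/-- A positive arc: a solution of `u'' + g u = p` on `[a, b]` that vanishes at the end points and
lies above `parab κ a b`. -/
structure IsArc (g p : ℝ → ℝ) (κ a b : ℝ) (u v : ℝ → ℝ) : Prop
    extends IsMotionOn g p (Icc a b) u v where
  left : u a = 0
  right : u b = 0
  lower : ∀ t ∈ Icc a b, parab κ a b t ≤ u t

namespace IsArc

variable {g p u v : ℝ → ℝ} {κ a b : ℝ}

lemma nonneg (h : IsArc g p κ a b u v) (hκ : 0 ≤ κ) {t : ℝ} (ht : t ∈ Icc a b) : 0 ≤ u t :=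
  (parab_nonneg hκ ht).trans (h.lower t ht)

lemma pos (h : IsArc g p κ a b u v) (hκ : 0 < κ) {t : ℝ} (ht : t ∈ Ioo a b) : 0 < u t :=
  (parab_pos hκ ht).trans_le (h.lower t (Ioo_subset_Icc_self ht))

lemma comp_neg (h : IsArc g p κ a b u v) :
    IsArc g (fun t => p (-t)) κ (-b) (-a) (fun t => u (-t)) (fun t => -v (-t)) where
  toIsMotionOn := h.toIsMotionOn.comp_neg.mono
    fun _ ht => ⟨by linarith [ht.2], by linarith [ht.1]⟩
  left := by rw [neg_neg, h.right]
  right := by rw [neg_neg, h.left]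
  lower t ht := (by unfold parab; ring : parab κ (-b) (-a) t = parab κ a b (-t)).trans_le
    (h.lower (-t) ⟨by linarith [ht.2], by linarith [ht.1]⟩)

lemma translate {τ : ℝ} (h : IsArc g p κ a b u v) (hp : Function.Periodic p τ) :
    IsArc g p κ (a + τ) (b + τ) (fun t => u (t - τ)) (fun t => v (t - τ)) where
  toIsMotionOn := (h.toIsMotionOn.translate hp).mono
    fun _ ht => ⟨by linarith [ht.1], by linarith [ht.2]⟩
  left := by rw [add_sub_cancel_right, h.left]
  right := by rw [add_sub_cancel_right, h.right]
  lower t ht := (by unfold parab; ring : parab κ (a + τ) (b + τ) t = parab κ a b (t - τ)).trans_le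
    (h.lower (t - τ) ⟨by linarith [ht.1], by linarith [ht.2]⟩)

end IsArc

/-- The standing hypotheses for positive arcs: the force `g` is bounded, Lipschitz, monotone, and
concave on the positive axis with limit `G` at `+∞`; the forcing term `p` is bounded, and its
primitive stays within `B` of the linear function of slope `m < G`. -/
structure OneSidedForce (g p : ℝ → ℝ) (m G M B : ℝ) (K : ℝ≥0) : Prop where
  lip : LipschitzWith K g
  bound : ∀ s, |g s| ≤ M
  mono : Monotone g
  lim : Tendsto g atTop (𝓝 G)
  concave : ConcaveOn ℝ (Ioi 0) g
  cont : Continuous p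
  bound_p : ∀ t, |p t| ≤ M
  mean : ∀ s t, |(∫ r in s..t, p r) - m * (t - s)| ≤ B
  gap : m < G

namespace OneSidedForce

section

variable {g p : ℝ → ℝ} {m G M B : ℝ} {K : ℝ≥0}

lemma continuous_g (h : OneSidedForce g p m G M B K) : Continuous g := h.lip.continuous

lemma M_nonneg (h : OneSidedForce g p m G M B K) : 0 ≤ M := (abs_nonneg _).trans (h.bound 0)

lemma B_nonneg (h : OneSidedForce g p m G M B K) : 0 ≤ B := (abs_nonneg _).trans (h.mean 0 0)

lemma gap_pos (h : OneSidedForce g p m G M B K) : 0 < G - m := sub_pos.2 h.gap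

lemma le_lim (h : OneSidedForce g p m G M B K) (s : ℝ) : g s ≤ G :=
  h.mono.ge_of_tendsto h.lim s

lemma abs_sub_le (h : OneSidedForce g p m G M B K) (x y : ℝ) : |g x - g y| ≤ K * |x - y| :=
  h.lip.dist_le_mul x y

lemma comp_neg (h : OneSidedForce g p m G M B K) :
    OneSidedForce g (fun t => p (-t)) m G M B K where
  lip := h.lip
  bound := h.bound
  mono := h.mono
  lim := h.lim
  concave := h.concave
  cont := h.cont.comp continuous_neg
  bound_p t := h.bound_p _
  mean s t := by
    rw [intervalIntegral.integral_comp_neg, ← neg_sub_neg s t]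
    have := h.mean (-t) (-s)
    rwa [neg_sub_neg, ← neg_sub_neg s t] at this
  gap := h.gap

lemma eventually_longEnough (h : OneSidedForce g p m G M B K) :
    ∀ᶠ L in atTop, LongEnough g m G B L := by
  have hA := h.gap_pos
  have hdeficit := (tendsto_deficit_div h.continuous_g h.bound h.lim
    (by linarith : 0 < (G - m) / 4)).eventually_lt_const (by linarith : 0 < (G - m) / 16)
  have hmean : ∀ᶠ L in atTop, 2 * B ≤ (G - m) / 8 * L :=
    (tendsto_id.const_mul_atTop (by linarith : 0 < (G - m) / 8)).eventually_ge_atTop _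
  filter_upwards [hdeficit, hmean, eventually_gt_atTop 0] with L hdef hB hL
  exact ⟨hL, hB, ((div_lt_iff₀ hL).1 hdef).le⟩

lemma integral_sub_mul_force_le (h : OneSidedForce g p m G M B K) {a t : ℝ} (hat : a ≤ t)
    {γ ω : ℝ → ℝ} (hγ : Continuous γ) (hω : Continuous ω) (hω0 : ∀ s, 0 ≤ ω s)
    (hγω : ∀ s ∈ Icc a t, G - ω s ≤ γ s) :
    ∫ s in a..t, (s - a) * (p s - γ s) ≤
      (t - a) * (B - (G - m) * (t - a) / 2 + ∫ s in a..t, ω s) := by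
  have hp := h.cont
  have hosc : ∫ s in a..t, (s - a) * (p s - m) ≤ B * (t - a) :=
    integral_sub_mul_le_of_integral_le (by fun_prop) hat fun s _ => by
      rw [intervalIntegral.integral_sub (hp.intervalIntegrable _ _)
        (continuous_const.intervalIntegrable _ _), intervalIntegral.integral_const, smul_eq_mul,
        mul_comm]
      exact (abs_le.1 (h.mean s t)).2
  have hlin : ∫ s in a..t, (s - a) = (t - a) ^ 2 / 2 := by
    rw [intervalIntegral.integral_comp_sub_right (fun s => s) a, integral_id]
    ring
  calc ∫ s in a..t, (s - a) * (p s - γ s)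
      ≤ ∫ s in a..t, ((s - a) * (p s - m) - (G - m) * (s - a) + (t - a) * ω s) := by
        refine intervalIntegral.integral_mono_on hat
          (Continuous.intervalIntegrable (by fun_prop) _ _)
          (Continuous.intervalIntegrable (by fun_prop) _ _) fun s hs => ?_
        have := mul_le_mul_of_nonneg_left (hγω s hs) (sub_nonneg.2 hs.1)
        have := mul_le_mul_of_nonneg_right (by linarith [hs.2] : s - a ≤ t - a) (hω0 s)
        linarith
    _ = (∫ s in a..t, (s - a) * (p s - m)) - (G - m) * (∫ s in a..t, (s - a))
          + (t - a) * ∫ s in a..t, ω s := by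
        rw [intervalIntegral.integral_add (Continuous.intervalIntegrable (by fun_prop) _ _)
          (Continuous.intervalIntegrable (by fun_prop) _ _),
          intervalIntegral.integral_sub (Continuous.intervalIntegrable (by fun_prop) _ _)
          (Continuous.intervalIntegrable (by fun_prop) _ _), intervalIntegral.integral_const_mul,
          intervalIntegral.integral_const_mul]
    _ ≤ (t - a) * (B - (G - m) * (t - a) / 2 + ∫ s in a..t, ω s) := by
        rw [hlin]
        linarith

lemma integral_sub_mul_force_le' (h : OneSidedForce g p m G M B K) {t b : ℝ} (htb : t ≤ b)
    {γ ω : ℝ → ℝ} (hγ : Continuous γ) (hω : Continuous ω) (hω0 : ∀ s, 0 ≤ ω s)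
    (hγω : ∀ s ∈ Icc t b, G - ω s ≤ γ s) :
    ∫ s in t..b, (b - s) * (p s - γ s) ≤
      (b - t) * (B - (G - m) * (b - t) / 2 + ∫ s in t..b, ω s) := by
  have hrefl := h.comp_neg.integral_sub_mul_force_le (neg_le_neg htb)
    (γ := fun s => γ (-s)) (ω := fun s => ω (-s)) (by fun_prop) (by fun_prop) (fun s => hω0 _)
    (fun s hs => hγω (-s) ⟨by linarith [hs.2], by linarith [hs.1]⟩)
  have hint := intervalIntegral.integral_comp_neg (a := -b) (b := -t)
    (fun s => (b - s) * (p s - γ s))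
  rw [intervalIntegral.integral_comp_neg, neg_sub_neg, neg_neg, neg_neg] at hrefl
  rw [neg_neg, neg_neg] at hint
  rw [← hint]
  simpa only [sub_neg_eq_add, add_comm] using hrefl

lemma dirichlet_lower_bound (h : OneSidedForce g p m G M B K) {a b t : ℝ} (ht : t ∈ Icc a b)
    {u v γ ω : ℝ → ℝ} (hγ : Continuous γ) (hω : Continuous ω) (hω0 : ∀ s, 0 ≤ ω s)
    (hγω : ∀ s ∈ Icc a b, G - ω s ≤ γ s) (hu : ∀ s, HasDerivAt u (v s) s)
    (hv : ∀ s ∈ Icc a b, HasDerivAt v (p s - γ s) s) (ha : u a = 0) (hb : u b = 0) :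
    (t - a) * (b - t) * ((G - m) * (b - a) / 2 - 2 * B - ∫ s in a..b, ω s) ≤ (b - a) * u t := by
  have hp := h.cont
  have hleft := mul_le_mul_of_nonneg_left (h.integral_sub_mul_force_le ht.1 hγ hω hω0
    fun s hs => hγω s ⟨hs.1, hs.2.trans ht.2⟩) (sub_nonneg.2 ht.2)
  have hright := mul_le_mul_of_nonneg_left (h.integral_sub_mul_force_le' ht.2 hγ hω hω0
    fun s hs => hγω s ⟨ht.1.trans hs.1, hs.2⟩) (sub_nonneg.2 ht.1)
  rw [green_representation hu (by fun_prop) hv ht, ha, hb,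
    ← intervalIntegral.integral_add_adjacent_intervals (hω.intervalIntegrable a t)
    (hω.intervalIntegrable t b)]
  linarith

end

section Arcs

variable {g p : ℝ → ℝ} {m G M B : ℝ} {K : ℝ≥0} {a b : ℝ} {u v u' v' : ℝ → ℝ}

lemma integral_parab_le_deficit (h : OneSidedForce g p m G M B K) {κ : ℝ} (hκ : 0 ≤ κ)
    (hab : a ≤ b) : ∫ s in a..b, (G - g (parab κ a b s)) ≤ deficit g G κ (b - a) := by
  have hg := h.continuous_g
  rw [← integral_half_parab_eq_deficit]
  refine intervalIntegral.integral_mono_on hab (Continuous.intervalIntegrable (by fun_prop) _ _)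
    (Continuous.intervalIntegrable (by fun_prop) _ _) fun s hs => ?_
  linarith [h.mono (half_le_self (parab_nonneg hκ hs))]

lemma lower_bound_of_parab_le (h : OneSidedForce g p m G M B K) {γ : ℝ → ℝ} (hγ : Continuous γ)
    (hγl : ∀ s ∈ Icc a b, g (parab ((G - m) / 4) a b s) ≤ γ s)
    (hu : ∀ s, HasDerivAt u (v s) s)
    (hv : ∀ s ∈ Icc a b, HasDerivAt v (p s - γ s) s) (ha : u a = 0) (hb : u b = 0)
    {t : ℝ} (ht : t ∈ Icc a b) :
    (t - a) * (b - t) * ((G - m) * (b - a) / 2 - 2 * B - deficit g G ((G - m) / 4) (b - a))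
      ≤ (b - a) * u t := by
  have hg := h.continuous_g
  have hdeficit := h.integral_parab_le_deficit (by linarith [h.gap_pos] : 0 ≤ (G - m) / 4)
    (ht.1.trans ht.2)
  refine le_trans (mul_le_mul_of_nonneg_left (by linarith)
    (mul_nonneg (sub_nonneg.2 ht.1) (sub_nonneg.2 ht.2)))
    (h.dirichlet_lower_bound ht hγ (ω := fun s => G - g (parab ((G - m) / 4) a b s))
      (by fun_prop) (fun s => sub_nonneg.2 (h.le_lim _)) (fun s hs => ?_) hu hv ha hb)
  linarith [hγl s hs]

lemma parab_le_of_longEnough (h : OneSidedForce g p m G M B K)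
    (hL : LongEnough g m G B (b - a)) {γ : ℝ → ℝ} (hγ : Continuous γ)
    (hγl : ∀ s ∈ Icc a b, g (parab ((G - m) / 4) a b s) ≤ γ s)
    (hu : ∀ s, HasDerivAt u (v s) s)
    (hv : ∀ s ∈ Icc a b, HasDerivAt v (p s - γ s) s) (ha : u a = 0) (hb : u b = 0)
    {t : ℝ} (ht : t ∈ Icc a b) : parab ((G - m) / 4) a b t ≤ u t := by
  obtain ⟨hpos, hB, hdeficit⟩ := hL
  have hA := mul_pos h.gap_pos hpos
  refine le_of_mul_le_mul_left ?_ hpos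
  calc (b - a) * parab ((G - m) / 4) a b t
      = (t - a) * (b - t) * ((b - a) * ((G - m) / 4)) := by unfold parab; ring
    _ ≤ _ := mul_le_mul_of_nonneg_left (by linarith)
        (mul_nonneg (sub_nonneg.2 ht.1) (sub_nonneg.2 ht.2))
    _ ≤ (b - a) * u t := h.lower_bound_of_parab_le hγ hγl hu hv ha hb ht

-- Truncating `g` below the parabola gives a solvable problem whose solution lies above the
-- parabola, hence solves the original equation.
theorem exists_arc (h : OneSidedForce g p m G M B K) (hL : LongEnough g m G B (b - a)) :
    ∃ u v, IsArc g p ((G - m) / 4) a b u v := by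
  have hg := h.continuous_g
  have hp := h.cont
  have hlip : ∀ t, LipschitzWith K fun x => p t - g (max (parab ((G - m) / 4) a b t) x) :=
    fun t => by
      simpa only [mul_one, zero_add, Function.comp_def, id] using
        (LipschitzWith.const (p t)).sub (h.lip.comp (LipschitzWith.id.const_max _))
  obtain ⟨u, v, ha, hb, hu, hv⟩ := exists_dirichlet_solution
    (f := fun t x => p t - g (max (parab ((G - m) / 4) a b t) x)) (M := M + M)
    (fun x => by fun_prop) hlip
    (fun t x => (abs_sub _ _).trans (add_le_add (h.bound_p _) (h.bound _))) (sub_pos.1 hL.1)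
  have huc := continuous_of_hasDerivAt hu
  have hlow : ∀ t ∈ Icc a b, parab ((G - m) / 4) a b t ≤ u t := fun t ht =>
    h.parab_le_of_longEnough hL (γ := fun s => g (max (parab ((G - m) / 4) a b s) (u s)))
      (by fun_prop) (fun s _ => h.mono (le_max_left _ _)) hu (fun s _ => hv s) ha hb ht
  refine ⟨u, v, ⟨hu, continuous_of_hasDerivAt hv, fun t ht => ?_⟩, ha, hb, hlow⟩
  simpa only [max_eq_right (hlow t ht)] using hv t

lemma arc_lower_bound (h : OneSidedForce g p m G M B K) (hu : IsArc g p ((G - m) / 4) a b u v)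
    {t : ℝ} (ht : t ∈ Icc a b) :
    (t - a) * (b - t) * ((G - m) * (b - a) / 2 - 2 * B - deficit g G ((G - m) / 4) (b - a))
      ≤ (b - a) * u t :=
  h.lower_bound_of_parab_le (h.continuous_g.comp hu.continuous_fst)
    (fun s hs => h.mono (hu.lower s hs)) hu.deriv_fst hu.deriv_snd hu.left hu.right ht

lemma abs_force_sub_le_of_abs_sub_le (h : OneSidedForce g p m G M B K) {μ x y X Z : ℝ}
    (hμ : 0 ≤ μ) (hx : μ ≤ x) (hy : μ ≤ y) (hX : 0 ≤ X) (hZ : 0 ≤ Z)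
    (hxy : |x - y| ≤ X + μ * Z) :
    |g x - g y| ≤ K * X + 2 * (G - g (μ / 2)) * Z := by
  have hlip := h.abs_sub_le x y
  have hω : 0 ≤ G - g (μ / 2) := sub_nonneg.2 (h.le_lim _)
  rcases (abs_nonneg (x - y)).eq_or_lt with heq | hne
  · rw [← heq, mul_zero] at hlip
    exact hlip.trans (by positivity)
  · refine le_of_mul_le_mul_right ?_ hne
    have hsplit := mul_le_mul_of_nonneg_left hxy (abs_nonneg (g x - g y))
    have hlipX := mul_le_mul_of_nonneg_right hlip hX
    have hconcZ := mul_le_mul_of_nonneg_right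
      (abs_sub_mul_le_of_concaveOn h.mono h.concave h.le_lim hμ hx hy) hZ
    linarith

/-! Two solutions above the parabola that agree at `a` are compared through the total variation
`Φ` of the difference of their forces: Green's formula bounds the difference of the solutions
by `Φ`, and concavity bounds `Φ` by one half of itself plus the difference at `b`. -/

lemma abs_sub_le_of_integral_force (hab : a < b) (hg : Continuous g)
    (hu : IsMotionOn g p (Icc a b) u v) (hu' : IsMotionOn g p (Icc a b) u' v') (ha : u' a = u a)
    {s : ℝ} (hs : s ∈ Icc a b) :
    |u' s - u s| ≤ |u' b - u b|
      + (s - a) * (b - s) * ((∫ r in a..b, |g (u r) - g (u' r)|) / (b - a)) := by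
  have huc := hu.continuous_fst
  have huc' := hu'.continuous_fst
  have hL : 0 < b - a := sub_pos.2 hab
  have hgreen := abs_green_le (φ := fun r => g (u r) - g (u' r))
    (fun r => (hu'.deriv_fst r).sub (hu.deriv_fst r)) (by fun_prop)
    (fun r hr => ((hu'.deriv_snd r hr).sub (hu.deriv_snd r hr)).congr_deriv (by ring)) hs
    (by simp only [Pi.sub_apply, ha, sub_self])
  simp only [Pi.sub_apply] at hgreen
  refine le_of_mul_le_mul_left (hgreen.trans ?_) hL
  rw [mul_add, mul_left_comm (b - a), mul_div_cancel₀ _ hL.ne']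
  gcongr
  exact hs.2

lemma integral_abs_force_sub_le (h : OneSidedForce g p m G M B K)
    (hL : LongEnough g m G B (b - a)) (hu : IsMotionOn g p (Icc a b) u v)
    (hul : ∀ t ∈ Icc a b, parab ((G - m) / 4) a b t ≤ u t)
    (hu' : IsMotionOn g p (Icc a b) u' v')
    (hul' : ∀ t ∈ Icc a b, parab ((G - m) / 4) a b t ≤ u' t) (ha : u' a = u a) :
    ∫ s in a..b, |g (u s) - g (u' s)| ≤ 2 * K * (b - a) * |u' b - u b| := by
  have hg := h.continuous_g
  have huc := hu.continuous_fst
  have huc' := hu'.continuous_fst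
  have hab : a < b := sub_pos.1 hL.1
  have hκ : 0 < (G - m) / 4 := by linarith [h.gap_pos]
  set X := |u' b - u b|
  set Φ := ∫ s in a..b, |g (u s) - g (u' s)|
  set Z := Φ / ((b - a) * ((G - m) / 4)) with hZ
  have hΦ : 0 ≤ Φ := intervalIntegral.integral_nonneg hab.le fun _ _ => abs_nonneg _
  have hforce : ∀ s ∈ Icc a b, |g (u s) - g (u' s)|
      ≤ K * X + 2 * (G - g (parab ((G - m) / 4) a b s / 2)) * Z := fun s hs => by
    refine h.abs_force_sub_le_of_abs_sub_le (parab_nonneg hκ.le hs) (hul s hs) (hul' s hs)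
      (abs_nonneg _) (div_nonneg hΦ (mul_pos hL.1 hκ).le) ?_
    rw [abs_sub_comm]
    refine (abs_sub_le_of_integral_force hab hg hu hu' ha hs).trans_eq ?_
    rw [hZ, parab, mul_comm ((G - m) / 4), div_mul_eq_div_div, mul_assoc _ ((G - m) / 4),
      mul_div_cancel₀ _ hκ.ne']
  have hint : Φ ≤ K * X * (b - a) + 2 * deficit g G ((G - m) / 4) (b - a) * Z := by
    refine (intervalIntegral.integral_mono_on hab.le
      (Continuous.intervalIntegrable (by fun_prop) _ _)
      (Continuous.intervalIntegrable (by fun_prop) _ _) hforce).trans_eq ?_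
    rw [intervalIntegral.integral_add (Continuous.intervalIntegrable (by fun_prop) _ _)
      (Continuous.intervalIntegrable (by fun_prop) _ _), intervalIntegral.integral_const,
      smul_eq_mul, intervalIntegral.integral_mul_const, intervalIntegral.integral_const_mul,
      integral_half_parab_eq_deficit, mul_comm (b - a)]
  have hhalf : 2 * deficit g G ((G - m) / 4) (b - a) * Z ≤ Φ / 2 := by
    rw [hZ, mul_div_assoc', div_le_iff₀ (mul_pos hL.1 hκ)]
    linarith [mul_le_mul_of_nonneg_right hL.2.2 hΦ]
  linarith

theorem abs_sub_le_of_motions (h : OneSidedForce g p m G M B K)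
    (hL : LongEnough g m G B (b - a)) (hu : IsMotionOn g p (Icc a b) u v)
    (hul : ∀ t ∈ Icc a b, parab ((G - m) / 4) a b t ≤ u t)
    (hu' : IsMotionOn g p (Icc a b) u' v')
    (hul' : ∀ t ∈ Icc a b, parab ((G - m) / 4) a b t ≤ u' t) (ha : u' a = u a)
    {t : ℝ} (ht : t ∈ Icc a b) :
    |u' t - u t| ≤ (1 + 2 * K * (b - a) ^ 2) * |u' b - u b| := by
  have hΦ := h.integral_abs_force_sub_le hL hu hul hu' hul' ha
  have hle : (t - a) * (b - t) ≤ (b - a) * (b - a) :=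
    mul_le_mul (by linarith [ht.2]) (by linarith [ht.1]) (sub_nonneg.2 ht.2) hL.1.le
  have hpos : 0 ≤ ∫ r in a..b, |g (u r) - g (u' r)| :=
    intervalIntegral.integral_nonneg (sub_pos.1 hL.1).le fun _ _ => abs_nonneg _
  calc |u' t - u t| ≤ |u' b - u b|
        + (b - a) * (b - a) * ((∫ r in a..b, |g (u r) - g (u' r)|) / (b - a)) :=
        (abs_sub_le_of_integral_force (sub_pos.1 hL.1) h.continuous_g hu hu' ha ht).trans
          (add_le_add le_rfl (mul_le_mul_of_nonneg_right hle (div_nonneg hpos hL.1.le)))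
    _ = |u' b - u b| + (b - a) * ∫ r in a..b, |g (u r) - g (u' r)| := by
        rw [mul_assoc, mul_div_cancel₀ _ hL.1.ne']
    _ ≤ |u' b - u b| + (b - a) * (2 * K * (b - a) * |u' b - u b|) :=
        add_le_add le_rfl (mul_le_mul_of_nonneg_left hΦ hL.1.le)
    _ = (1 + 2 * K * (b - a) ^ 2) * |u' b - u b| := by ring

theorem abs_deriv_sub_le_of_motions (h : OneSidedForce g p m G M B K)
    (hL : LongEnough g m G B (b - a)) (hu : IsMotionOn g p (Icc a b) u v)
    (hul : ∀ t ∈ Icc a b, parab ((G - m) / 4) a b t ≤ u t)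
    (hu' : IsMotionOn g p (Icc a b) u' v')
    (hul' : ∀ t ∈ Icc a b, parab ((G - m) / 4) a b t ≤ u' t) (ha : u' a = u a) :
    (b - a) * |v' b - v b| ≤ (1 + 2 * K * (b - a) ^ 2) * |u' b - u b| := by
  have hg := h.continuous_g
  have huc := hu.continuous_fst
  have huc' := hu'.continuous_fst
  have hab : a ≤ b := (sub_pos.1 hL.1).le
  have hparts := integral_sub_mul_second_deriv (a := a) (t := b)
    (φ := fun s => g (u s) - g (u' s)) (fun s => (hu'.deriv_fst s).sub (hu.deriv_fst s))
    (by fun_prop) (fun s hs => ((hu'.deriv_snd s (by rwa [uIcc_of_le hab] at hs)).sub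
      (hu.deriv_snd s (by rwa [uIcc_of_le hab] at hs))).congr_deriv (by ring)) a
  simp only [Pi.sub_apply, ha, sub_self, zero_mul, sub_zero] at hparts
  have hmoment : |∫ s in a..b, (s - a) * (g (u s) - g (u' s))|
      ≤ (b - a) * (2 * K * (b - a) * |u' b - u b|) :=
    (abs_integral_mul_le hab (by fun_prop) (by fun_prop) fun s hs => by
      rw [abs_of_nonneg (sub_nonneg.2 hs.1)]; linarith [hs.2]).trans
      (mul_le_mul_of_nonneg_left (h.integral_abs_force_sub_le hL hu hul hu' hul' ha) hL.1.le)
  calc (b - a) * |v' b - v b| = |(b - a) * (v' b - v b)| := by rw [abs_mul, abs_of_pos hL.1]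
    _ = |(∫ s in a..b, (s - a) * (g (u s) - g (u' s))) + (u' b - u b)| := by
        rw [hparts, sub_add_cancel]
    _ ≤ (b - a) * (2 * K * (b - a) * |u' b - u b|) + |u' b - u b| :=
        (abs_add_le _ _).trans (add_le_add hmoment le_rfl)
    _ = (1 + 2 * K * (b - a) ^ 2) * |u' b - u b| := by ring

theorem arc_unique (h : OneSidedForce g p m G M B K) (hL : LongEnough g m G B (b - a))
    (hu : IsArc g p ((G - m) / 4) a b u v) (hu' : IsArc g p ((G - m) / 4) a b u' v') :
    EqOn u' u (Icc a b) := by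
  intro t ht
  have hdiff := h.abs_sub_le_of_motions hL hu.toIsMotionOn hu.lower hu'.toIsMotionOn hu'.lower
    (by rw [hu.left, hu'.left]) ht
  rw [hu.right, hu'.right, sub_self, abs_zero, mul_zero] at hdiff
  exact sub_eq_zero.1 (abs_nonpos_iff.1 hdiff)

end Arcs

end OneSidedForce

section Action

/-- The potential of the force `g`: its primitive vanishing at `0`. -/
noncomputable def prim (g : ℝ → ℝ) (x : ℝ) : ℝ := ∫ y in (0 : ℝ)..x, g y

variable {g p u v u' v' : ℝ → ℝ} {K : ℝ≥0} {a b c X : ℝ}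

lemma hasDerivAt_prim (hg : Continuous g) (x : ℝ) : HasDerivAt (prim g) (g x) x :=
  (hg.integral_hasStrictDerivAt 0 x).hasDerivAt

lemma continuous_prim (hg : Continuous g) : Continuous (prim g) :=
  continuous_of_hasDerivAt (hasDerivAt_prim hg)

lemma prim_sub_prim (hg : Continuous g) (x y : ℝ) : prim g y - prim g x = ∫ z in x..y, g z :=
  intervalIntegral.integral_interval_sub_left (hg.intervalIntegrable _ _)
    (hg.intervalIntegrable _ _)

lemma abs_prim_le {M : ℝ} (hM : ∀ y, |g y| ≤ M) (x : ℝ) : |prim g x| ≤ M * |x| := by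
  simpa only [prim, sub_zero, Real.norm_eq_abs] using
    intervalIntegral.norm_integral_le_of_norm_le_const (a := 0) (b := x) (f := g) fun y _ => hM y

lemma abs_trapezoid_sub_prim_le (hg : LipschitzWith K g) (x y : ℝ) :
    |(g x + g y) / 2 * (y - x) - (prim g y - prim g x)| ≤ K * (y - x) ^ 2 := by
  have hint : (g x + g y) / 2 * (y - x) - (prim g y - prim g x) =
      ∫ z in x..y, ((g x + g y) / 2 - g z) := by
    rw [intervalIntegral.integral_sub (continuous_const.intervalIntegrable _ _)
      (hg.continuous.intervalIntegrable _ _), prim_sub_prim hg.continuous,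
      intervalIntegral.integral_const, smul_eq_mul, mul_comm]
  have hmid : ∀ z ∈ Ι x y, ‖(g x + g y) / 2 - g z‖ ≤ K * |y - x| := fun z hz => by
    have hz' : z ∈ uIcc x y := uIoc_subset_uIcc hz
    have hx : |g x - g z| ≤ K * |y - x| := (hg.dist_le_mul x z).trans
      (mul_le_mul_of_nonneg_left
        (by rw [Real.dist_eq, abs_sub_comm]; exact abs_sub_left_of_mem_uIcc hz') K.coe_nonneg)
    have hy : |g y - g z| ≤ K * |y - x| := (hg.dist_le_mul y z).trans
      (mul_le_mul_of_nonneg_left (abs_sub_right_of_mem_uIcc hz') K.coe_nonneg)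
    rw [abs_le] at hx hy
    rw [Real.norm_eq_abs, abs_le]
    constructor <;> linarith
  rw [hint, ← Real.norm_eq_abs, ← sq_abs (y - x), sq, ← mul_assoc]
  exact intervalIntegral.norm_integral_le_of_norm_le_const hmid

lemma abs_integral_trapezoid_sub_prim_le (hg : LipschitzWith K g) (hab : a ≤ b)
    (hX : ∀ t ∈ Icc a b, |u' t - u t| ≤ X) :
    |∫ t in a..b, ((g (u t) + g (u' t)) / 2 * (u' t - u t) - (prim g (u' t) - prim g (u t)))|
      ≤ K * X ^ 2 * (b - a) := by
  rw [← abs_of_nonneg (sub_nonneg.2 hab), ← Real.norm_eq_abs]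
  refine intervalIntegral.norm_integral_le_of_norm_le_const fun t ht => ?_
  rw [uIoc_of_le hab] at ht
  refine (abs_trapezoid_sub_prim_le hg _ _).trans (mul_le_mul_of_nonneg_left ?_ K.coe_nonneg)
  rw [← sq_abs]
  exact pow_le_pow_left₀ (abs_nonneg _) (hX t (Ioc_subset_Icc_self ht)) 2

/-- The action functional of the equation `u'' + g u = p` on `[a, b]`, with `v` in the role of
the velocity `u'`. -/
noncomputable def action (g p : ℝ → ℝ) (a b : ℝ) (u v : ℝ → ℝ) : ℝ :=
  ∫ t in a..b, (v t ^ 2 / 2 - prim g (u t) + p t * u t)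

lemma action_comp_neg :
    action g (fun t => p (-t)) (-b) (-a) (fun t => u (-t)) (fun t => -v (-t)) =
      action g p a b u v := by
  have hneg := intervalIntegral.integral_comp_neg (a := -b) (b := -a)
    (fun t => v t ^ 2 / 2 - prim g (u t) + p t * u t)
  rw [neg_neg, neg_neg] at hneg
  rw [action, action, ← hneg]
  simp only [neg_sq]

lemma action_translate {τ : ℝ} (hp : Function.Periodic p τ) :
    action g p (a + τ) (b + τ) (fun t => u (t - τ)) (fun t => v (t - τ)) =
      action g p a b u v := by
  have hshift := intervalIntegral.integral_comp_sub_right (a := a + τ) (b := b + τ)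
    (fun t => v t ^ 2 / 2 - prim g (u t) + p t * u t) τ
  simpa only [action, add_sub_cancel_right, hp.sub_eq] using hshift

lemma action_add_adjacent (hg : Continuous g) (hp : Continuous p) (hu : Continuous u)
    (hv : Continuous v) : action g p a b u v + action g p b c u v = action g p a c u v := by
  have hprim := continuous_prim hg
  exact intervalIntegral.integral_add_adjacent_intervals
    (Continuous.intervalIntegrable (by fun_prop) _ _)
    (Continuous.intervalIntegrable (by fun_prop) _ _)

-- Up to the trapezoid error of `prim g`, the difference of the actions of two motions is a
-- boundary term: integrate the derivative of `(v + v') / 2 * (u' - u)`.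
lemma action_sub_action (hg : Continuous g) (hp : Continuous p) (hab : a ≤ b)
    (hu : IsMotionOn g p (Icc a b) u v) (hu' : IsMotionOn g p (Icc a b) u' v') :
    action g p a b u' v' - action g p a b u v =
      ((v b + v' b) / 2 * (u' b - u b) - (v a + v' a) / 2 * (u' a - u a)) +
      ∫ t in a..b, ((g (u t) + g (u' t)) / 2 * (u' t - u t) - (prim g (u' t) - prim g (u t))) := by
  have hprim := continuous_prim hg
  have huc := hu.continuous_fst
  have huc' := hu'.continuous_fst
  have hvc := hu.cont
  have hvc' := hu'.cont
  have hboundary := intervalIntegral.integral_eq_sub_of_hasDerivAt (a := a) (b := b)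
    (f := fun t => (v t + v' t) / 2 * (u' t - u t))
    (f' := fun t => ((p t - g (u t)) + (p t - g (u' t))) / 2 * (u' t - u t) +
      (v t + v' t) / 2 * (v' t - v t))
    (fun t ht => by
      rw [uIcc_of_le hab] at ht
      exact (((hu.deriv_snd t ht).add (hu'.deriv_snd t ht)).div_const 2).mul
        ((hu'.deriv_fst t).sub (hu.deriv_fst t)))
    (Continuous.intervalIntegrable (by fun_prop) _ _)
  rw [← hboundary, action, action, ← intervalIntegral.integral_sub
    (Continuous.intervalIntegrable (by fun_prop) _ _)
    (Continuous.intervalIntegrable (by fun_prop) _ _), ← intervalIntegral.integral_add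
    (Continuous.intervalIntegrable (by fun_prop) _ _)
    (Continuous.intervalIntegrable (by fun_prop) _ _)]
  congr 1
  ext t
  ring

open Classical in
/-- The action of the positive arc on `[a, b]` as a function of the end points, with the junk
value `0` if there is no such arc. It does not depend on the chosen arc when `b - a` is long
enough, see `OneSidedForce.arcAction_eq`. -/
noncomputable def arcAction (g p : ℝ → ℝ) (κ a b : ℝ) : ℝ :=
  if h : ∃ z : (ℝ → ℝ) × (ℝ → ℝ), IsArc g p κ a b z.1 z.2 then
    action g p a b h.choose.1 h.choose.2 else 0

end Action

namespace OneSidedForce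

section ArcAction

variable {g p u v u' v' : ℝ → ℝ} {m G M B a b : ℝ} {K : ℝ≥0}

lemma arc_unique_deriv (h : OneSidedForce g p m G M B K) (hL : LongEnough g m G B (b - a))
    (hu : IsArc g p ((G - m) / 4) a b u v) (hu' : IsArc g p ((G - m) / 4) a b u' v') :
    EqOn v' v (Icc a b) := by
  have hinterior : EqOn v' v (Ioo a b) := fun t ht =>
    (hu'.deriv_fst t).unique ((hu.deriv_fst t).congr_of_eventuallyEq
      ((h.arc_unique hL hu hu').eventuallyEq_of_mem (Icc_mem_nhds ht.1 ht.2)))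
  simpa only [closure_Ioo (sub_pos.1 hL.1).ne] using hinterior.closure hu'.cont hu.cont

lemma arcAction_eq (h : OneSidedForce g p m G M B K) (hL : LongEnough g m G B (b - a))
    (hu : IsArc g p ((G - m) / 4) a b u v) :
    arcAction g p ((G - m) / 4) a b = action g p a b u v := by
  have hex : ∃ z : (ℝ → ℝ) × (ℝ → ℝ), IsArc g p ((G - m) / 4) a b z.1 z.2 := ⟨(u, v), hu⟩
  rw [arcAction, dif_pos hex]
  refine intervalIntegral.integral_congr fun t ht => ?_
  rw [uIcc_of_le (sub_pos.1 hL.1).le] at ht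
  simp only [h.arc_unique hL hu hex.choose_spec ht, h.arc_unique_deriv hL hu hex.choose_spec ht]

lemma arcAction_comp_neg (h : OneSidedForce g p m G M B K) (hL : LongEnough g m G B (b - a)) :
    arcAction g (fun t => p (-t)) ((G - m) / 4) (-b) (-a) = arcAction g p ((G - m) / 4) a b := by
  obtain ⟨u, v, hu⟩ := h.exists_arc hL
  rw [h.arcAction_eq hL hu, h.comp_neg.arcAction_eq (by rwa [neg_sub_neg]) hu.comp_neg,
    action_comp_neg]

lemma arcAction_translate (h : OneSidedForce g p m G M B K) (hL : LongEnough g m G B (b - a))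
    {τ : ℝ} (hp : Function.Periodic p τ) :
    arcAction g p ((G - m) / 4) (a + τ) (b + τ) = arcAction g p ((G - m) / 4) a b := by
  obtain ⟨u, v, hu⟩ := h.exists_arc hL
  rw [h.arcAction_eq hL hu, h.arcAction_eq (by rwa [add_sub_add_right_eq_sub])
    (hu.translate hp), action_translate hp]

lemma abs_accel_le (h : OneSidedForce g p m G M B K) (t x : ℝ) : |p t - g x| ≤ 2 * M := by
  linarith [abs_sub (p t) (g x), h.bound_p t, h.bound x]

lemma abs_deriv_sub_le (h : OneSidedForce g p m G M B K) (hu : IsMotionOn g p (Icc a b) u v)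
    {s t : ℝ} (hs : s ∈ Icc a b) (ht : t ∈ Icc a b) : |v t - v s| ≤ 2 * M * |t - s| :=
  abs_sub_le_of_hasDerivAt (convex_Icc a b) hu.deriv_snd (fun _ _ => h.abs_accel_le _ _) hs ht

lemma abs_deriv_le (h : OneSidedForce g p m G M B K) (hab : a < b)
    (hu : IsArc g p ((G - m) / 4) a b u v) {t : ℝ} (ht : t ∈ Icc a b) :
    |v t| ≤ 2 * M * (b - a) := by
  obtain ⟨s, hs, hs0⟩ := exists_hasDerivAt_eq_zero hab hu.continuous_fst.continuousOn
    (by rw [hu.left, hu.right]) (fun s _ => hu.deriv_fst s)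
  have hvel := h.abs_deriv_sub_le hu.toIsMotionOn (Ioo_subset_Icc_self hs) ht
  rw [hs0, sub_zero] at hvel
  refine hvel.trans (mul_le_mul_of_nonneg_left ?_ (by linarith [h.M_nonneg]))
  exact abs_le.2 ⟨by linarith [ht.1, hs.2], by linarith [ht.2, hs.1]⟩

lemma abs_le_mul_sub_right (h : OneSidedForce g p m G M B K) (hab : a < b)
    (hu : IsArc g p ((G - m) / 4) a b u v) {t : ℝ} (ht : t ∈ Icc a b) :
    |u t| ≤ 2 * M * (b - a) * (b - t) := by
  have hpos := abs_sub_le_of_hasDerivAt (convex_Icc a b) (fun s _ => hu.deriv_fst s)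
    (fun s hs => h.abs_deriv_le hab hu hs) (right_mem_Icc.2 hab.le) ht
  rwa [hu.right, sub_zero, abs_sub_comm, abs_of_nonneg (sub_nonneg.2 ht.2)] at hpos

end ArcAction

section Variation

variable {g p u v u' v' : ℝ → ℝ} {m G M B a b b' Λ V W : ℝ} {K : ℝ≥0}

lemma isMotionOn_and_parab_le_of_le (h : OneSidedForce g p m G M B K) (hbb' : b ≤ b')
    (hu' : IsArc g p ((G - m) / 4) a b' u' v') :
    IsMotionOn g p (Icc a b) u' v' ∧ ∀ t ∈ Icc a b, parab ((G - m) / 4) a b t ≤ u' t := by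
  refine ⟨hu'.toIsMotionOn.mono (Icc_subset_Icc_right hbb'), fun t ht =>
    le_trans ?_ (hu'.lower t ⟨ht.1, ht.2.trans hbb'⟩)⟩
  exact mul_le_mul_of_nonneg_left (mul_le_mul_of_nonneg_left (by linarith)
    (sub_nonneg.2 ht.1)) (by linarith [h.gap_pos])

lemma mul_abs_sub_right_le (h : OneSidedForce g p m G M B K) (hL : LongEnough g m G B (b - a))
    (hbb' : b ≤ b') (hΛ : b' - a ≤ Λ) (hV : 2 * M * Λ ≤ V) (hW : (1 + 2 * K * Λ ^ 2) * V ≤ W)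
    (hu : IsArc g p ((G - m) / 4) a b u v) (hu' : IsArc g p ((G - m) / 4) a b' u' v') :
    (1 + 2 * K * (b - a) ^ 2) * |u' b - u b| ≤ W * (b' - b) := by
  have hM := h.M_nonneg
  have hab := hL.1
  have : 0 ≤ b' - b := sub_nonneg.2 hbb'
  rw [hu.right, sub_zero]
  calc (1 + 2 * K * (b - a) ^ 2) * |u' b|
      ≤ (1 + 2 * K * Λ ^ 2) * (2 * M * (b' - a) * (b' - b)) := by
        gcongr
        · linarith
        · exact h.abs_le_mul_sub_right (by linarith) hu' ⟨by linarith, hbb'⟩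
    _ ≤ (1 + 2 * K * Λ ^ 2) * (2 * M * Λ * (b' - b)) := by gcongr
    _ ≤ (1 + 2 * K * Λ ^ 2) * (V * (b' - b)) := by gcongr
    _ ≤ W * (b' - b) := by rw [← mul_assoc]; gcongr

lemma abs_sub_le_of_le_right (h : OneSidedForce g p m G M B K)
    (hL : LongEnough g m G B (b - a)) (hbb' : b ≤ b') (hΛ : b' - a ≤ Λ) (hV : 2 * M * Λ ≤ V)
    (hW : (1 + 2 * K * Λ ^ 2) * V ≤ W) (hu : IsArc g p ((G - m) / 4) a b u v)
    (hu' : IsArc g p ((G - m) / 4) a b' u' v') {t : ℝ} (ht : t ∈ Icc a b) :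
    |u' t - u t| ≤ W * (b' - b) := by
  obtain ⟨hmotion, hlower⟩ := h.isMotionOn_and_parab_le_of_le hbb' hu'
  exact (h.abs_sub_le_of_motions hL hu.toIsMotionOn hu.lower hmotion hlower
    (by rw [hu.left, hu'.left]) ht).trans (h.mul_abs_sub_right_le hL hbb' hΛ hV hW hu hu')

lemma abs_deriv_sub_le_of_le_right (h : OneSidedForce g p m G M B K)
    (hL : LongEnough g m G B (b - a)) (hL1 : 1 ≤ b - a) (hbb' : b ≤ b') (hΛ : b' - a ≤ Λ)
    (hV : 2 * M * Λ ≤ V) (hW : (1 + 2 * K * Λ ^ 2) * V ≤ W)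
    (hu : IsArc g p ((G - m) / 4) a b u v) (hu' : IsArc g p ((G - m) / 4) a b' u' v') :
    |v' b - v b| ≤ W * (b' - b) := by
  obtain ⟨hmotion, hlower⟩ := h.isMotionOn_and_parab_le_of_le hbb' hu'
  exact (le_mul_of_one_le_left (abs_nonneg _) hL1).trans
    ((h.abs_deriv_sub_le_of_motions hL hu.toIsMotionOn hu.lower hmotion hlower
      (by rw [hu.left, hu'.left])).trans (h.mul_abs_sub_right_le hL hbb' hΛ hV hW hu hu'))

lemma abs_deriv_sub_left_le (h : OneSidedForce g p m G M B K)
    (hu' : IsMotionOn g p (Icc b b') u' v') {t : ℝ} (ht : t ∈ Icc b b') :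
    |v' t - v' b| ≤ 2 * M * (b' - b) := by
  refine (h.abs_deriv_sub_le hu' ⟨le_rfl, ht.1.trans ht.2⟩ ht).trans
    (mul_le_mul_of_nonneg_left ?_ (by linarith [h.M_nonneg]))
  rw [abs_of_nonneg (sub_nonneg.2 ht.1)]
  linarith [ht.2]

lemma abs_lagrangian_sub_le (h : OneSidedForce g p m G M B K) (hbb' : b ≤ b')
    (hu' : IsMotionOn g p (Icc b b') u' v') (hvV : ∀ t ∈ Icc b b', |v' t| ≤ V)
    (huV : ∀ t ∈ Icc b b', |u' t| ≤ V * (b' - b)) {t : ℝ} (ht : t ∈ Icc b b') :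
    |v' t ^ 2 / 2 - prim g (u' t) + p t * u' t - v' b ^ 2 / 2| ≤ 4 * M * V * (b' - b) := by
  have hM := h.M_nonneg
  have hkinetic : |v' t ^ 2 / 2 - v' b ^ 2 / 2| ≤ 2 * M * (b' - b) * V := by
    have hmean : |(v' t + v' b) / 2| ≤ V := by
      have ht := abs_le.1 (hvV t ht)
      have hb := abs_le.1 (hvV b (left_mem_Icc.2 hbb'))
      exact abs_le.2 ⟨by linarith, by linarith⟩
    rw [show v' t ^ 2 / 2 - v' b ^ 2 / 2 = (v' t - v' b) * ((v' t + v' b) / 2) by ring, abs_mul]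
    exact mul_le_mul (h.abs_deriv_sub_left_le hu' ht) hmean (abs_nonneg _)
      (mul_nonneg (by linarith) (sub_nonneg.2 hbb'))
  have hprim_le : |prim g (u' t)| ≤ M * (V * (b' - b)) :=
    (abs_prim_le h.bound _).trans (mul_le_mul_of_nonneg_left (huV t ht) hM)
  have hforcing : |p t * u' t| ≤ M * (V * (b' - b)) := by
    rw [abs_mul]
    exact mul_le_mul (h.bound_p t) (huV t ht) (abs_nonneg _) hM
  rw [abs_le] at hkinetic hprim_le hforcing ⊢
  constructor <;> linarith

lemma abs_action_sub_le_of_short (h : OneSidedForce g p m G M B K) (hbb' : b ≤ b')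
    (hu' : IsMotionOn g p (Icc b b') u' v') (hvV : ∀ t ∈ Icc b b', |v' t| ≤ V)
    (huV : ∀ t ∈ Icc b b', |u' t| ≤ V * (b' - b)) :
    |action g p b b' u' v' - v' b ^ 2 / 2 * (b' - b)| ≤ 4 * M * V * (b' - b) ^ 2 := by
  have hp := h.cont
  have hprim := continuous_prim h.continuous_g
  have huc := hu'.continuous_fst
  have hvc := hu'.cont
  have hint : action g p b b' u' v' - v' b ^ 2 / 2 * (b' - b) =
      ∫ t in b..b', (v' t ^ 2 / 2 - prim g (u' t) + p t * u' t - v' b ^ 2 / 2) := by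
    rw [intervalIntegral.integral_sub (Continuous.intervalIntegrable (by fun_prop) _ _)
      (continuous_const.intervalIntegrable _ _), intervalIntegral.integral_const, smul_eq_mul,
      action, mul_comm (b' - b)]
  rw [hint, sq (b' - b), ← mul_assoc, ← Real.norm_eq_abs]
  nth_rewrite 2 [← abs_of_nonneg (sub_nonneg.2 hbb')]
  refine intervalIntegral.norm_integral_le_of_norm_le_const fun t ht => ?_
  rw [uIoc_of_le hbb'] at ht
  exact h.abs_lagrangian_sub_le hbb' hu' hvV huV (Ioc_subset_Icc_self ht)

lemma abs_boundary_term_le (h : OneSidedForce g p m G M B K) (hbb' : b ≤ b')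
    (hu' : IsMotionOn g p (Icc b b') u' v') (hright : u' b' = 0) {y : ℝ} (hy : |y| ≤ V)
    (hvV : |v' b| ≤ V) (hW : |v' b - y| ≤ W * (b' - b)) :
    |(y + v' b) / 2 * u' b + v' b ^ 2 / 2 * (b' - b) + y ^ 2 / 2 * (b' - b)|
      ≤ (2 * M * V + V * W / 2) * (b' - b) ^ 2 := by
  have hδ : 0 ≤ b' - b := sub_nonneg.2 hbb'
  have hV : 0 ≤ V := (abs_nonneg _).trans hy
  have htaylor : |u' b + v' b * (b' - b)| ≤ 2 * M * (b' - b) ^ 2 := by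
    have := abs_sub_linear_le_of_hasDerivAt hbb' (fun t _ => hu'.deriv_fst t) hu'.deriv_snd
      (fun _ _ => h.abs_accel_le _ _)
    rwa [hright, zero_sub, ← neg_add', abs_neg] at this
  have hmean : |(y + v' b) / 2| ≤ V := by
    rw [abs_le] at hy hvV ⊢
    constructor <;> linarith
  calc |(y + v' b) / 2 * u' b + v' b ^ 2 / 2 * (b' - b) + y ^ 2 / 2 * (b' - b)|
      = |(y + v' b) / 2 * (u' b + v' b * (b' - b)) - y * (v' b - y) / 2 * (b' - b)| := by
        congr 1; ring
    _ ≤ |(y + v' b) / 2| * |u' b + v' b * (b' - b)| + |y| * |v' b - y| / 2 * (b' - b) := by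
        refine (abs_sub _ _).trans_eq ?_
        rw [abs_mul ((y + v' b) / 2), abs_mul (y * (v' b - y) / 2), abs_div (y * (v' b - y)),
          abs_mul y, abs_two, abs_of_nonneg hδ]
    _ ≤ V * (2 * M * (b' - b) ^ 2) + V * (W * (b' - b)) / 2 * (b' - b) := by gcongr
    _ = (2 * M * V + V * W / 2) * (b' - b) ^ 2 := by ring

lemma abs_action_variation_le_of_le (h : OneSidedForce g p m G M B K)
    (hL : LongEnough g m G B (b - a)) (hL1 : 1 ≤ b - a) (hbb' : b ≤ b') (hΛ : b' - a ≤ Λ)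
    (hV : 2 * M * Λ ≤ V) (hW : (1 + 2 * K * Λ ^ 2) * V ≤ W)
    (hu : IsArc g p ((G - m) / 4) a b u v) (hu' : IsArc g p ((G - m) / 4) a b' u' v') :
    |action g p a b' u' v' - action g p a b u v + v b ^ 2 / 2 * (b' - b)|
      ≤ (6 * M * V + V * W / 2 + K * W ^ 2 * Λ) * (b' - b) ^ 2 := by
  have hM := h.M_nonneg
  have : 0 ≤ b' - b := sub_nonneg.2 hbb'
  have hbound : ∀ x, x ≤ Λ → 2 * M * x ≤ V := fun x hx =>
    (mul_le_mul_of_nonneg_left hx (by linarith)).trans hV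
  have hvV' : ∀ t ∈ Icc b b', |v' t| ≤ V := fun t ht =>
    (h.abs_deriv_le (by linarith) hu' ⟨by linarith [ht.1], ht.2⟩).trans (hbound _ hΛ)
  have huV' : ∀ t ∈ Icc b b', |u' t| ≤ V * (b' - b) := fun t ht =>
    (h.abs_le_mul_sub_right (by linarith) hu' ⟨by linarith [ht.1], ht.2⟩).trans
      (mul_le_mul (hbound _ hΛ) (by linarith [ht.1]) (by linarith [ht.2])
        ((abs_nonneg _).trans (hvV' t ht)))
  have htail_motion : IsMotionOn g p (Icc b b') u' v' :=
    hu'.toIsMotionOn.mono (Icc_subset_Icc_left (by linarith))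
  have hdiff := action_sub_action h.continuous_g h.cont (by linarith) hu.toIsMotionOn
    (h.isMotionOn_and_parab_le_of_le hbb' hu').1
  rw [hu.left, hu'.left, hu.right, sub_self, mul_zero, sub_zero, sub_zero] at hdiff
  have hboundary := h.abs_boundary_term_le hbb' htail_motion hu'.right
    ((h.abs_deriv_le (by linarith) hu ⟨by linarith, le_rfl⟩).trans (hbound _ (by linarith)))
    (hvV' b ⟨le_rfl, hbb'⟩) (h.abs_deriv_sub_le_of_le_right hL hL1 hbb' hΛ hV hW hu hu')
  have htrapezoid := abs_integral_trapezoid_sub_prim_le h.lip (by linarith)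
    (fun t ht => h.abs_sub_le_of_le_right hL hbb' hΛ hV hW hu hu' ht)
  have htail := h.abs_action_sub_le_of_short hbb' htail_motion hvV' huV'
  have hlen : K * (W * (b' - b)) ^ 2 * (b - a) ≤ K * (W * (b' - b)) ^ 2 * Λ :=
    mul_le_mul_of_nonneg_left (by linarith) (by positivity)
  rw [← action_add_adjacent (b := b) h.continuous_g h.cont hu'.continuous_fst hu'.cont]
  rw [abs_le] at hboundary htrapezoid htail ⊢
  constructor <;> linarith

lemma abs_deriv_right_sub_le_of_le (h : OneSidedForce g p m G M B K)
    (hL : LongEnough g m G B (b - a)) (hL1 : 1 ≤ b - a) (hbb' : b ≤ b') (hΛ : b' - a ≤ Λ)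
    (hV : 2 * M * Λ ≤ V) (hW : (1 + 2 * K * Λ ^ 2) * V ≤ W)
    (hu : IsArc g p ((G - m) / 4) a b u v) (hu' : IsArc g p ((G - m) / 4) a b' u' v') :
    |v' b' - v b| ≤ (2 * M + W) * (b' - b) := by
  have hshort := h.abs_deriv_sub_left_le (hu'.toIsMotionOn.mono
    (Icc_subset_Icc_left (by linarith))) (right_mem_Icc.2 hbb')
  have hcompare := h.abs_deriv_sub_le_of_le_right hL hL1 hbb' hΛ hV hW hu hu'
  linarith [_root_.abs_sub_le (v' b') (v' b) (v b)]

theorem abs_action_variation_le (h : OneSidedForce g p m G M B K)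
    (hL : LongEnough g m G B (b - a)) (hL' : LongEnough g m G B (b' - a)) (hL1 : 1 ≤ b - a)
    (hL1' : 1 ≤ b' - a) (hΛ : b - a ≤ Λ) (hΛ' : b' - a ≤ Λ)
    (hV : 2 * M * Λ ≤ V) (hW : (1 + 2 * K * Λ ^ 2) * V ≤ W)
    (hu : IsArc g p ((G - m) / 4) a b u v) (hu' : IsArc g p ((G - m) / 4) a b' u' v') :
    |action g p a b' u' v' - action g p a b u v + v b ^ 2 / 2 * (b' - b)|
      ≤ (6 * M * V + V * W / 2 + K * W ^ 2 * Λ + V * (2 * M + W)) * (b' - b) ^ 2 := by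
  have hM := h.M_nonneg
  have hbound : ∀ x, x ≤ Λ → 2 * M * x ≤ V := fun x hx =>
    (mul_le_mul_of_nonneg_left hx (by linarith)).trans hV
  have hvV := (h.abs_deriv_le (by linarith) hu ⟨by linarith, le_rfl⟩).trans (hbound _ hΛ)
  have hvV' := (h.abs_deriv_le (by linarith) hu' ⟨by linarith, le_rfl⟩).trans (hbound _ hΛ')
  have hV0 : 0 ≤ V := (abs_nonneg _).trans hvV
  have hW0 : 0 ≤ W := le_trans (by positivity) hW
  have hmore : 0 ≤ V * (2 * M + W) * (b' - b) ^ 2 := by positivity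
  rcases le_total b b' with hbb' | hbb'
  · linarith [h.abs_action_variation_le_of_le hL hL1 hbb' hΛ' hV hW hu hu']
  · have hswap := h.abs_action_variation_le_of_le hL' hL1' hbb' hΛ hV hW hu' hu
    have hmean : |(v b + v' b') / 2| ≤ V := by
      rw [abs_le] at hvV hvV' ⊢
      constructor <;> linarith
    have hkinetic : |(v b - v' b') * ((v b + v' b') / 2) * (b - b')|
        ≤ (2 * M + W) * (b - b') * V * (b - b') := by
      rw [abs_mul, abs_mul, abs_of_nonneg (sub_nonneg.2 hbb')]
      have := sub_nonneg.2 hbb'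
      gcongr
      exact h.abs_deriv_right_sub_le_of_le hL' hL1' hbb' hΛ hV hW hu' hu
    rw [abs_le] at hswap hkinetic ⊢
    constructor <;> linarith

end Variation

section Differentiability

variable {g p u v : ℝ → ℝ} {m G M B a b b' h₀ Λ : ℝ} {K : ℝ≥0}

theorem hasDerivAt_arcAction_right (h : OneSidedForce g p m G M B K)
    (hh : ∀ L, h₀ ≤ L → LongEnough g m G B L) (h1 : 1 ≤ h₀) (hab : h₀ < b - a)
    (hu : IsArc g p ((G - m) / 4) a b u v) :
    HasDerivAt (fun s => arcAction g p ((G - m) / 4) a s) (-(v b ^ 2 / 2)) b := by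
  obtain ⟨V, hV⟩ : ∃ V, V = 2 * M * (b - a + 1) := ⟨_, rfl⟩
  obtain ⟨W, hW⟩ : ∃ W, W = (1 + 2 * K * (b - a + 1) ^ 2) * V := ⟨_, rfl⟩
  rw [hasDerivAt_iff_isLittleO]
  refine (Asymptotics.IsBigO.of_bound (g := fun s : ℝ => ‖s - b‖ ^ 2)
    (6 * M * V + V * W / 2 + K * W ^ 2 * (b - a + 1) + V * (2 * M + W)) ?_).trans_isLittleO
    (Asymptotics.isLittleO_pow_sub_sub b one_lt_two)
  filter_upwards [Ioo_mem_nhds (by linarith : a + h₀ < b) (lt_add_one b)] with s hs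
  have hs₀ : h₀ ≤ s - a := by linarith [hs.1]
  obtain ⟨w, z, hw⟩ := h.exists_arc (hh _ hs₀)
  have hvar := h.abs_action_variation_le (hh _ hab.le) (hh _ hs₀) (by linarith) (by linarith)
    (by linarith : b - a ≤ b - a + 1) (by linarith [hs.2]) hV.ge hW.ge hu hw
  rw [h.arcAction_eq (hh _ hs₀) hw, h.arcAction_eq (hh _ hab.le) hu, smul_eq_mul, mul_neg,
    sub_neg_eq_add, mul_comm (s - b), Real.norm_eq_abs, norm_pow, norm_norm, Real.norm_eq_abs,
    sq_abs]
  exact hvar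

theorem hasDerivAt_arcAction_left (h : OneSidedForce g p m G M B K)
    (hh : ∀ L, h₀ ≤ L → LongEnough g m G B L) (h1 : 1 ≤ h₀) (hab : h₀ < b - a)
    (hu : IsArc g p ((G - m) / 4) a b u v) :
    HasDerivAt (fun s => arcAction g p ((G - m) / 4) s b) (v a ^ 2 / 2) a := by
  have hrefl := (h.comp_neg.hasDerivAt_arcAction_right hh h1
    (by linarith : h₀ < -a - -b) hu.comp_neg).comp a (hasDerivAt_neg a)
  simp only [neg_neg, neg_sq, mul_neg, mul_one] at hrefl
  refine hrefl.congr_of_eventuallyEq ?_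
  filter_upwards [eventually_lt_nhds (by linarith : a < b - h₀)] with s hs
  exact (h.arcAction_comp_neg (hh _ (by linarith))).symm

lemma abs_arcAction_sub_le (h : OneSidedForce g p m G M B K)
    (hh : ∀ L, h₀ ≤ L → LongEnough g m G B L) (h1 : 1 ≤ h₀) (hb : b ∈ Ioo (a + h₀) (a + Λ))
    (hb' : b' ∈ Ioo (a + h₀) (a + Λ)) :
    |arcAction g p ((G - m) / 4) a b' - arcAction g p ((G - m) / 4) a b|
      ≤ (2 * M * Λ) ^ 2 / 2 * |b' - b| := by
  have hM := h.M_nonneg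
  have hlong : ∀ s ∈ Ioo (a + h₀) (a + Λ), h₀ < s - a := fun s hs => by linarith [hs.1]
  choose! w z hw using fun s (hs : s ∈ Ioo (a + h₀) (a + Λ)) =>
    h.exists_arc (hh _ (hlong s hs).le)
  refine abs_sub_le_of_hasDerivAt (convex_Ioo _ _)
    (fun s hs => h.hasDerivAt_arcAction_right hh h1 (hlong s hs) (hw s hs)) (fun s hs => ?_)
    hb hb'
  have has : a < s := by linarith [hs.1]
  have hvel : |z s s| ≤ 2 * M * Λ := (h.abs_deriv_le has (hw s hs) ⟨has.le, le_rfl⟩).trans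
    (mul_le_mul_of_nonneg_left (by linarith [hs.2]) (by linarith))
  rw [abs_neg, abs_div, abs_two, abs_pow]
  gcongr

theorem continuousAt_arcAction (h : OneSidedForce g p m G M B K)
    (hh : ∀ L, h₀ ≤ L → LongEnough g m G B L) (h1 : 1 ≤ h₀) (hab : h₀ < b - a) :
    ContinuousAt (fun z : ℝ × ℝ => arcAction g p ((G - m) / 4) z.1 z.2) (a, b) := by
  obtain ⟨w, z, hw⟩ := h.exists_arc (hh _ hab.le)
  have hleft : Tendsto (fun z : ℝ × ℝ => arcAction g p ((G - m) / 4) z.1 b) (𝓝 (a, b))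
      (𝓝 (arcAction g p ((G - m) / 4) a b)) :=
    (h.hasDerivAt_arcAction_left hh h1 hab hw).continuousAt.tendsto.comp
      continuous_fst.continuousAt
  have hright : Tendsto (fun z : ℝ × ℝ => arcAction g p ((G - m) / 4) z.1 z.2 -
      arcAction g p ((G - m) / 4) z.1 b) (𝓝 (a, b)) (𝓝 0) := by
    have hbound : Tendsto (fun z : ℝ × ℝ => (2 * M * (b - a + 2)) ^ 2 / 2 * |z.2 - b|)
        (𝓝 (a, b)) (𝓝 0) := by
      have : Continuous fun z : ℝ × ℝ => (2 * M * (b - a + 2)) ^ 2 / 2 * |z.2 - b| := by fun_prop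
      simpa only [sub_self, abs_zero, mul_zero] using this.tendsto (a, b)
    refine squeeze_zero_norm' ?_ hbound
    have hfst : ∀ᶠ z : ℝ × ℝ in 𝓝 (a, b), z.1 ∈ Ioo (a - 1) (b - h₀) :=
      continuous_fst.continuousAt (Ioo_mem_nhds (by linarith) (by linarith))
    have hsnd : ∀ᶠ z : ℝ × ℝ in 𝓝 (a, b), z.2 ∈ Iio (b + 1) :=
      continuous_snd.continuousAt (Iio_mem_nhds (by linarith))
    have hgap : ∀ᶠ z : ℝ × ℝ in 𝓝 (a, b), h₀ < z.2 - z.1 :=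
      (by fun_prop : Continuous fun z : ℝ × ℝ => z.2 - z.1).continuousAt.eventually_const_lt hab
    filter_upwards [hfst, hsnd, hgap] with z hz₁ hz₂ hz
    exact h.abs_arcAction_sub_le hh h1 ⟨by linarith [hz₁.2], by linarith [hz₁.1]⟩
      ⟨by linarith, by linarith [hz₁.1, mem_Iio.1 hz₂]⟩
  simpa only [ContinuousAt, sub_add_cancel, zero_add] using hright.add hleft

end Differentiability

end OneSidedForce

lemma integral_sub_midpoint_sq (a b : ℝ) :
    ∫ t in a..b, (t - (a + b) / 2) ^ 2 = (b - a) ^ 3 / 12 := by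
  rw [intervalIntegral.integral_comp_sub_right (fun t => t ^ 2), integral_pow]
  push_cast
  ring

lemma integral_sub_left_mul_sub_right (a b : ℝ) :
    ∫ t in a..b, (t - a) * (b - t) = (b - a) ^ 3 / 6 := by
  have hsub : ∀ t, (t - a) * (b - t) = ((b - a) / 2) ^ 2 - (t - (a + b) / 2) ^ 2 := fun t => by
    ring
  simp_rw [hsub]
  rw [intervalIntegral.integral_sub (Continuous.intervalIntegrable (by fun_prop) _ _)
    (Continuous.intervalIntegrable (by fun_prop) _ _), integral_sub_midpoint_sq,
    intervalIntegral.integral_const, smul_eq_mul]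
  ring

lemma IsArc.integral_mul_velocity {g p u v w w' : ℝ → ℝ} {κ a b : ℝ} (hu : IsArc g p κ a b u v)
    (hab : a ≤ b) (hw : ∀ t ∈ Icc a b, HasDerivAt w (w' t) t) (hw' : Continuous w') :
    ∫ t in a..b, w t * v t = -∫ t in a..b, w' t * u t := by
  rw [← uIcc_of_le hab] at hw
  rw [intervalIntegral.integral_mul_deriv_eq_deriv_mul hw (fun t _ => hu.deriv_fst t)
    (hw'.intervalIntegrable _ _) (hu.cont.intervalIntegrable _ _), hu.left, hu.right, mul_zero,
    mul_zero, sub_zero, zero_sub]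

namespace OneSidedForce

section Asymptotics

variable {g p u v : ℝ → ℝ} {m G M B a b : ℝ} {K : ℝ≥0}

lemma lim_le_bound (h : OneSidedForce g p m G M B K) : G ≤ M :=
  le_of_tendsto' h.lim fun s => (le_abs_self _).trans (h.bound s)

lemma prim_le (h : OneSidedForce g p m G M B K) {x : ℝ} (hx : 0 ≤ x) : prim g x ≤ G * x := by
  have hmono := intervalIntegral.integral_mono_on (μ := volume) hx
    (h.continuous_g.intervalIntegrable 0 x) (intervalIntegrable_const (c := G))
    fun y _ => h.le_lim y
  rwa [intervalIntegral.integral_const, smul_eq_mul, sub_zero, mul_comm] at hmono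

lemma exists_le_prim (h : OneSidedForce g p m G M B K) {η : ℝ} (hη : 0 < η) :
    ∃ C, ∀ x, 0 ≤ x → (G - η) * x - C ≤ prim g x := by
  obtain ⟨R, hR⟩ := eventually_atTop.1 ((h.lim.eventually_const_le (sub_lt_self G hη)).and
    (eventually_ge_atTop 0))
  have hR0 : 0 ≤ R := (hR R le_rfl).2
  have hG : G - η ≤ M := by linarith [h.lim_le_bound]
  refine ⟨2 * M * R, fun x hx => ?_⟩
  rcases le_total x R with hxR | hRx
  · have hprim := neg_le_of_abs_le (abs_prim_le h.bound x)
    rw [abs_of_nonneg hx] at hprim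
    linarith [mul_le_mul_of_nonneg_right hG hx, mul_le_mul_of_nonneg_left hxR h.M_nonneg]
  · have hprim := neg_le_of_abs_le (abs_prim_le h.bound R)
    have htail := intervalIntegral.integral_mono_on (μ := volume) hRx
      (intervalIntegrable_const (c := G - η)) (h.continuous_g.intervalIntegrable R x)
      fun y hy => (hR y hy.1).1
    rw [intervalIntegral.integral_const, smul_eq_mul, ← prim_sub_prim h.continuous_g] at htail
    rw [abs_of_nonneg hR0] at hprim
    linarith [mul_le_mul_of_nonneg_right hG hR0]

lemma abs_integral_sub_mean_mul_le (h : OneSidedForce g p m G M B K) (hab : a < b)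
    (hu : IsArc g p ((G - m) / 4) a b u v) :
    |∫ t in a..b, (p t - m) * u t| ≤ 2 * M * B * (b - a) ^ 2 := by
  have hp := h.cont
  have hprimitive : ∀ t, HasDerivAt (fun t => ∫ r in a..t, (p r - m)) (p t - m) t := fun t =>
    ((by fun_prop : Continuous fun r => p r - m).integral_hasStrictDerivAt a t).hasDerivAt
  have hprimitive_le : ∀ t, |∫ r in a..t, (p r - m)| ≤ B := fun t => by
    rw [intervalIntegral.integral_sub (hp.intervalIntegrable _ _) intervalIntegrable_const,
      intervalIntegral.integral_const, smul_eq_mul, mul_comm]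
    exact h.mean a t
  rw [← abs_neg, ← hu.integral_mul_velocity hab.le (fun t _ => hprimitive t) (by fun_prop)]
  calc |∫ t in a..b, (∫ r in a..t, (p r - m)) * v t| ≤ B * (2 * M * (b - a)) * |b - a| := by
        rw [← Real.norm_eq_abs]
        refine intervalIntegral.norm_integral_le_of_norm_le_const fun t ht => ?_
        rw [uIoc_of_le hab.le] at ht
        rw [norm_mul]
        exact mul_le_mul (hprimitive_le t) (h.abs_deriv_le hab hu (Ioc_subset_Icc_self ht))
          (norm_nonneg _) h.B_nonneg
    _ = 2 * M * B * (b - a) ^ 2 := by rw [abs_of_pos (sub_pos.2 hab)]; ring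

-- The velocity is compared with that of the parabola with second derivative `-(G - m)`, the arc of
-- the equation with constant force `G` and constant forcing `m`.
lemma le_action (h : OneSidedForce g p m G M B K) (hab : a < b)
    (hu : IsArc g p ((G - m) / 4) a b u v) :
    -((G - m) ^ 2 / 24 * (b - a) ^ 3) - 2 * M * B * (b - a) ^ 2 ≤ action g p a b u v := by
  have hA := h.gap_pos
  have hp := h.cont
  have hprim := continuous_prim h.continuous_g
  have huc := hu.continuous_fst
  have hvc := hu.cont
  have hparabola : ∫ t in a..b, (-(G - m) * (t - (a + b) / 2)) * v t =
      -∫ t in a..b, -(G - m) * u t :=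
    hu.integral_mul_velocity hab.le (fun t _ => by
      simpa only [id_eq, mul_one] using
        ((hasDerivAt_id t).sub_const ((a + b) / 2)).const_mul (-(G - m))) continuous_const
  have hpoint : ∫ t in a..b, ((p t - m) * u t - (G - m) * u t +
      -(G - m) * (t - (a + b) / 2) * v t - (G - m) ^ 2 / 2 * (t - (a + b) / 2) ^ 2) ≤
      action g p a b u v := by
    refine intervalIntegral.integral_mono_on hab.le
      (Continuous.intervalIntegrable (by fun_prop) _ _)
      (Continuous.intervalIntegrable (by fun_prop) _ _) fun t ht => ?_
    linarith [h.prim_le (hu.nonneg (by linarith) ht),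
      sq_nonneg (v t - -(G - m) * (t - (a + b) / 2))]
  rw [intervalIntegral.integral_sub, intervalIntegral.integral_add,
    intervalIntegral.integral_sub, hparabola, intervalIntegral.integral_const_mul,
    intervalIntegral.integral_const_mul, intervalIntegral.integral_const_mul,
    integral_sub_midpoint_sq] at hpoint
  · linarith [neg_le_of_abs_le (h.abs_integral_sub_mean_mul_le hab hu)]
  all_goals exact Continuous.intervalIntegrable (by fun_prop) _ _

lemma action_eq_integral_virial (h : OneSidedForce g p m G M B K) (hab : a ≤ b) {κ : ℝ}
    (hu : IsArc g p κ a b u v) :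
    action g p a b u v = ∫ t in a..b, (u t * (g (u t) + p t) / 2 - prim g (u t)) := by
  have hp := h.cont
  have hg := h.continuous_g
  have hprim := continuous_prim hg
  have huc := hu.continuous_fst
  have hvc := hu.cont
  have hvirial := hu.integral_mul_velocity hab hu.deriv_snd (by fun_prop)
  rw [← sub_eq_zero, sub_neg_eq_add, ← intervalIntegral.integral_add
    (Continuous.intervalIntegrable (by fun_prop) _ _)
    (Continuous.intervalIntegrable (by fun_prop) _ _)] at hvirial
  rw [action, ← sub_eq_zero, ← intervalIntegral.integral_sub
    (Continuous.intervalIntegrable (by fun_prop) _ _)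
    (Continuous.intervalIntegrable (by fun_prop) _ _)]
  calc ∫ t in a..b, (v t ^ 2 / 2 - prim g (u t) + p t * u t -
        (u t * (g (u t) + p t) / 2 - prim g (u t)))
      = ∫ t in a..b, (v t * v t + (p t - g (u t)) * u t) / 2 := by
        congr 1; ext t; ring
    _ = 0 := by rw [intervalIntegral.integral_div, hvirial, zero_div]

lemma le_gap_mul_integral (h : OneSidedForce g p m G M B K) (hab : a < b)
    (hu : IsArc g p ((G - m) / 4) a b u v) :
    (G - m) ^ 2 / 24 * (b - a) ^ 3 -
        (G - m) / 12 * (2 * B + deficit g G ((G - m) / 4) (b - a)) * (b - a) ^ 2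
      ≤ (G - m) / 2 * ∫ t in a..b, u t := by
  have hL : 0 < b - a := sub_pos.2 hab
  obtain ⟨S, hS⟩ : ∃ S, S =
    ((G - m) * (b - a) / 2 - 2 * B - deficit g G ((G - m) / 4) (b - a)) / (b - a) := ⟨_, rfl⟩
  have hlower : S * ((b - a) ^ 3 / 6) ≤ ∫ t in a..b, u t := by
    rw [← integral_sub_left_mul_sub_right, ← intervalIntegral.integral_const_mul]
    refine intervalIntegral.integral_mono_on hab.le
      (Continuous.intervalIntegrable (by fun_prop) _ _)
      (hu.continuous_fst.intervalIntegrable _ _) fun t ht => ?_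
    rw [hS, div_mul_eq_mul_div, div_le_iff₀ hL, mul_comm (u t), mul_comm _ (_ * _)]
    exact h.arc_lower_bound hu ht
  refine le_of_eq_of_le ?_ (mul_le_mul_of_nonneg_left hlower (half_pos h.gap_pos).le)
  rw [hS]
  field_simp
  ring

lemma action_le (h : OneSidedForce g p m G M B K) (hab : a < b) {η C : ℝ} (hη : 0 ≤ η)
    (hC : ∀ x, 0 ≤ x → (G - η) * x - C ≤ prim g x) (hu : IsArc g p ((G - m) / 4) a b u v) :
    action g p a b u v ≤ -((G - m) ^ 2 / 24 * (b - a) ^ 3) + M * B * (b - a) ^ 2 +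
      (G - m) / 12 * (2 * B + deficit g G ((G - m) / 4) (b - a)) * (b - a) ^ 2 +
      2 * η * M * (b - a) ^ 3 + C * (b - a) := by
  have hM := h.M_nonneg
  have hA := h.gap_pos
  have hp := h.cont
  have hg := h.continuous_g
  have hprim := continuous_prim hg
  have huc := hu.continuous_fst
  have hpoint : action g p a b u v ≤ ∫ t in a..b,
      ((p t - m) * u t / 2 - (G - m) / 2 * u t + (2 * η * M * (b - a) ^ 2 + C)) := by
    rw [h.action_eq_integral_virial hab.le hu]
    refine intervalIntegral.integral_mono_on hab.le
      (Continuous.intervalIntegrable (by fun_prop) _ _)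
      (Continuous.intervalIntegrable (by fun_prop) _ _) fun t ht => ?_
    have hu0 := hu.nonneg (by linarith) ht
    have hu_le : u t ≤ 2 * M * (b - a) * (b - a) :=
      (le_abs_self _).trans ((h.abs_le_mul_sub_right hab hu ht).trans
        (mul_le_mul_of_nonneg_left (by linarith [ht.1]) (by nlinarith)))
    linarith [hC (u t) hu0, mul_le_mul_of_nonneg_left (h.le_lim (u t)) hu0,
      mul_le_mul_of_nonneg_left hu_le hη]
  rw [intervalIntegral.integral_add, intervalIntegral.integral_sub,
    intervalIntegral.integral_div, intervalIntegral.integral_const_mul,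
    intervalIntegral.integral_const, smul_eq_mul] at hpoint
  · linarith [le_of_abs_le (h.abs_integral_sub_mean_mul_le hab hu), h.le_gap_mul_integral hab hu]
  all_goals exact Continuous.intervalIntegrable (by fun_prop) _ _

lemma eventually_action_le (h : OneSidedForce g p m G M B K) {ε : ℝ} (hε : 0 < ε) :
    ∀ᶠ L in atTop, ∀ a b u v, b - a = L → IsArc g p ((G - m) / 4) a b u v →
      action g p a b u v ≤ -((G - m) ^ 2 / 24 * L ^ 3) + ε * L ^ 3 := by
  have hM := h.M_nonneg
  have hA := h.gap_pos
  obtain ⟨η, hη, hηM⟩ : ∃ η, 0 < η ∧ 2 * η * M ≤ ε / 2 := by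
    refine ⟨ε / (4 * (M + 1)), by positivity, ?_⟩
    rw [mul_div_assoc', div_mul_eq_mul_div, div_le_iff₀ (by positivity)]
    linarith
  obtain ⟨C, hC⟩ := h.exists_le_prim hη
  have hinv : Tendsto (fun L : ℝ => L⁻¹) atTop (𝓝 0) := tendsto_inv_atTop_zero
  have hdeficit := tendsto_deficit_div h.continuous_g h.bound h.lim
    (by linarith : 0 < (G - m) / 4)
  have herror : Tendsto (fun L : ℝ => M * B * L⁻¹ + (G - m) / 12 * (2 * B * L⁻¹ +
      deficit g G ((G - m) / 4) L / L) + C * (L⁻¹ * L⁻¹)) atTop (𝓝 0) := by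
    simpa only [mul_zero, add_zero] using ((hinv.const_mul (M * B)).add
      (((hinv.const_mul (2 * B)).add hdeficit).const_mul ((G - m) / 12))).add
      ((hinv.mul hinv).const_mul C)
  filter_upwards [herror.eventually_le_const (half_pos hε), eventually_gt_atTop 0]
    with L hL hL0 a b u v rfl hu
  have hcubic := mul_le_mul_of_nonneg_right (add_le_add hL hηM) (by positivity : 0 ≤ (b - a) ^ 3)
  refine (h.action_le (by linarith) hη.le hC hu).trans (le_trans (le_of_eq ?_)
    (add_le_add_right (hcubic.trans_eq (by ring)) _))
  field_simp
  ring

lemma eventually_le_action (h : OneSidedForce g p m G M B K) {ε : ℝ} (hε : 0 < ε) :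
    ∀ᶠ L in atTop, ∀ a b u v, b - a = L → IsArc g p ((G - m) / 4) a b u v →
      -((G - m) ^ 2 / 24 * L ^ 3) - ε * L ^ 3 ≤ action g p a b u v := by
  have herror : Tendsto (fun L : ℝ => 2 * M * B * L⁻¹) atTop (𝓝 0) := by
    simpa only [mul_zero] using tendsto_inv_atTop_zero.const_mul (2 * M * B)
  filter_upwards [herror.eventually_le_const hε, eventually_gt_atTop 0]
    with L hL hL0 a b u v rfl hu
  have hcubic := mul_le_mul_of_nonneg_right hL (by positivity : 0 ≤ (b - a) ^ 3)
  rw [show 2 * M * B * (b - a)⁻¹ * (b - a) ^ 3 = 2 * M * B * (b - a) ^ 2 by field_simp] at hcubic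
  linarith [h.le_action (by linarith) hu]

theorem eventually_abs_arcAction_add_le (h : OneSidedForce g p m G M B K) {ε : ℝ} (hε : 0 < ε) :
    ∀ᶠ L in atTop, ∀ a b, b - a = L →
      |arcAction g p ((G - m) / 4) a b + (G - m) ^ 2 / 24 * L ^ 3| ≤ ε * L ^ 3 := by
  filter_upwards [h.eventually_longEnough, h.eventually_action_le hε, h.eventually_le_action hε]
    with L hlong hle hge a b hab
  obtain ⟨u, v, hu⟩ := h.exists_arc (hab ▸ hlong : LongEnough g m G B (b - a))
  rw [h.arcAction_eq (hab ▸ hlong) hu, abs_le]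
  constructor <;> linarith [hle a b u v hab hu, hge a b u v hab hu]

end Asymptotics

end OneSidedForce

/-- Partitions `t 0 < t 1 < ⋯ < t N` of an interval of length `τ` into pieces of length at least
`h`; the values `t i` with `i > N` are irrelevant. -/
structure Admissible (N : ℕ) (h τ : ℝ) (t : ℕ → ℝ) : Prop where
  last : t N = t 0 + τ
  le_gap : ∀ i < N, h ≤ t (i + 1) - t i

/-- The total cost of a partition whose `i`-th piece `[a, b]` costs `c i a b`. -/
def totalCost (c : ℕ → ℝ → ℝ → ℝ) (N : ℕ) (t : ℕ → ℝ) : ℝ :=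
  ∑ i ∈ Finset.range N, c i (t i) (t (i + 1))

/-- Admissible partitions maximizing the total cost; their ends are free. -/
structure IsMaxPartition (c : ℕ → ℝ → ℝ → ℝ) (N : ℕ) (h τ : ℝ) (t : ℕ → ℝ) : Prop where
  admissible : Admissible N h τ t
  totalCost_le : ∀ s, Admissible N h τ s → totalCost c N s ≤ totalCost c N t

/-- The properties of the costs of arcs that control maximizing partitions: on pieces of length at
least `h` they are continuous, `T`-periodic, and equal to `-α i * L ^ 3` up to a relative error.
The field `exchange` makes it profitable to transfer between `δ X` and `2 δ X` of the length `X` of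
a long piece to a piece of length at most `δ X`. -/
structure ArcCosts (c : ℕ → ℝ → ℝ → ℝ) (α : ℕ → ℝ) (h ε δ T : ℝ) : Prop where
  period_pos : 0 < T
  h_pos : 0 < h
  δ_pos : 0 < δ
  δ_le : δ ≤ 1 / 3
  abs_ε_le : ∀ i, |ε| ≤ α i
  exchange : ∀ i j, (α j + ε) * (1 - δ) ^ 3 + (α i + ε) * (3 * δ) ^ 3 < α j - ε
  translate : ∀ i a b, h ≤ b - a → ∀ z : ℤ, c i (a + z * T) (b + z * T) = c i a b
  continuousAt : ∀ i a b, h ≤ b - a → ContinuousAt (fun x : ℝ × ℝ => c i x.1 x.2) (a, b)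
  abs_add_le : ∀ i a b, h ≤ b - a → |c i a b + α i * (b - a) ^ 3| ≤ ε * (b - a) ^ 3

namespace Admissible

variable {N : ℕ} {h τ : ℝ} {t : ℕ → ℝ}

lemma monotoneOn (ht : Admissible N h τ t) (hh : 0 ≤ h) : MonotoneOn t (Iic N) :=
  monotoneOn_of_le_add_one ordConnected_Iic fun i _ _ hi => by
    linarith [ht.le_gap i (Nat.lt_of_succ_le hi)]

lemma congr {s : ℕ → ℝ} (ht : Admissible N h τ t) (hst : ∀ i ≤ N, s i = t i) :
    Admissible N h τ s where
  last := by rw [hst N le_rfl, hst 0 N.zero_le, ht.last]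
  le_gap i hi := by rw [hst (i + 1) hi, hst i hi.le]; exact ht.le_gap i hi

lemma add_const (ht : Admissible N h τ t) (d : ℝ) : Admissible N h τ (fun i => t i + d) where
  last := by rw [ht.last]; ring
  le_gap i hi := by simpa only [add_sub_add_right_eq_sub] using ht.le_gap i hi

end Admissible

lemma admissible_equidistant {N : ℕ} {h τ : ℝ} (hN : 0 < N) (hτ : N * h ≤ τ) :
    Admissible N h τ (fun i => i * (τ / N)) where
  last := by field_simp; ring
  le_gap i _ := by
    have hh : h ≤ τ / N := by rwa [le_div_iff₀' (by positivity)]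
    push_cast
    linarith

lemma isClosed_setOf_admissible (N : ℕ) (h τ : ℝ) : IsClosed {t | Admissible N h τ t} := by
  have heq : {t | Admissible N h τ t} =
      {t | t N = t 0 + τ} ∩ ⋂ i, ⋂ (_ : i < N), {t | h ≤ t (i + 1) - t i} :=
    Set.ext fun t => ⟨fun ht => ⟨ht.last, mem_iInter₂.2 ht.le_gap⟩,
      fun ht => ⟨ht.1, mem_iInter₂.1 ht.2⟩⟩
  rw [heq]
  exact (isClosed_eq (by fun_prop) (by fun_prop)).inter
    (isClosed_iInter fun i => isClosed_iInter fun _ => isClosed_le (by fun_prop) (by fun_prop))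

lemma totalCost_congr {c : ℕ → ℝ → ℝ → ℝ} {N : ℕ} {s t : ℕ → ℝ} (hst : ∀ i ≤ N, s i = t i) :
    totalCost c N s = totalCost c N t :=
  Finset.sum_congr rfl fun i hi => by
    have hiN := Finset.mem_range.1 hi
    rw [hst i hiN.le, hst (i + 1) hiN]

namespace ArcCosts

variable {c : ℕ → ℝ → ℝ → ℝ} {α : ℕ → ℝ} {h ε δ T τ : ℝ} {N : ℕ} {t : ℕ → ℝ}

lemma le_cost (hc : ArcCosts c α h ε δ T) {a b : ℝ} (hab : h ≤ b - a) (i : ℕ) :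
    -((α i + ε) * (b - a) ^ 3) ≤ c i a b := by
  linarith [(abs_le.1 (hc.abs_add_le i a b hab)).1]

lemma cost_le (hc : ArcCosts c α h ε δ T) {a b : ℝ} (hab : h ≤ b - a) (i : ℕ) :
    c i a b ≤ -((α i - ε) * (b - a) ^ 3) := by
  linarith [(abs_le.1 (hc.abs_add_le i a b hab)).2]

lemma cost_nonpos (hc : ArcCosts c α h ε δ T) {a b : ℝ} (hab : h ≤ b - a) (i : ℕ) :
    c i a b ≤ 0 := by
  have hL : 0 ≤ b - a := hc.h_pos.le.trans hab
  have hα : 0 ≤ α i - ε := sub_nonneg.2 ((le_abs_self ε).trans (hc.abs_ε_le i))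
  exact (hc.cost_le hab i).trans (neg_nonpos.2 (by positivity))

lemma totalCost_translate (hc : ArcCosts c α h ε δ T) (ht : Admissible N h τ t) (z : ℤ) :
    totalCost c N (fun i => t i + z * T) = totalCost c N t :=
  Finset.sum_congr rfl fun i hi => hc.translate i _ _ (ht.le_gap i (Finset.mem_range.1 hi)) z

lemma exists_mem_pi_Icc_totalCost_eq (hc : ArcCosts c α h ε δ T) (ht : Admissible N h τ t) :
    ∃ s, Admissible N h τ s ∧ s ∈ univ.pi (fun _ => Icc 0 (T + τ)) ∧
      totalCost c N s = totalCost c N t := by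
  obtain ⟨z, hz, -⟩ := existsUnique_add_zsmul_mem_Ico hc.period_pos (t 0) 0
  rw [zsmul_eq_mul, zero_add] at hz
  have hmono := (ht.add_const (z * T)).monotoneOn hc.h_pos.le
  have hmin : ∀ i ≤ N, t (min i N) + z * T = t i + z * T := fun i hi => by rw [min_eq_left hi]
  refine ⟨fun i => t (min i N) + z * T, (ht.add_const _).congr hmin, fun i _ => ⟨?_, ?_⟩,
    (totalCost_congr hmin).trans (hc.totalCost_translate ht z)⟩
  · exact hz.1.trans (hmono N.zero_le (min_le_right i N) (min i N).zero_le)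
  · have hle := hmono (min_le_right i N) self_mem_Iic (min_le_right i N)
    simp only [ht.last] at hle
    linarith [hz.2]

lemma continuousOn_totalCost (hc : ArcCosts c α h ε δ T) :
    ContinuousOn (totalCost c N) {t | Admissible N h τ t} := by
  refine continuousOn_finsetSum _ fun i hi t ht => ?_
  have hcont := hc.continuousAt i (t i) (t (i + 1)) (ht.le_gap i (Finset.mem_range.1 hi))
  have hpair : ContinuousAt (fun t : ℕ → ℝ => (t i, t (i + 1))) t := by fun_prop
  exact (hcont.comp (f := fun t : ℕ → ℝ => (t i, t (i + 1))) hpair).continuousWithinAt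

theorem exists_isMaxPartition (hc : ArcCosts c α h ε δ T) (hN : 0 < N) (hτ : N * h ≤ τ) :
    ∃ t, IsMaxPartition c N h τ t := by
  set S : Set (ℕ → ℝ) := {t | Admissible N h τ t} ∩ univ.pi fun _ => Icc 0 (T + τ)
  have hcomp : IsCompact S :=
    (isCompact_univ_pi fun _ => isCompact_Icc).inter_left (isClosed_setOf_admissible N h τ)
  have hne : S.Nonempty := by
    obtain ⟨s, hs, hsI, -⟩ := hc.exists_mem_pi_Icc_totalCost_eq (admissible_equidistant hN hτ)
    exact ⟨s, hs, hsI⟩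
  obtain ⟨t, htS, htmax⟩ :=
    hcomp.exists_isMaxOn hne (hc.continuousOn_totalCost.mono inter_subset_left)
  refine ⟨t, htS.1, fun s hs => ?_⟩
  obtain ⟨s', hs', hsI, hss'⟩ := hc.exists_mem_pi_Icc_totalCost_eq hs
  exact hss'.ge.trans (htmax ⟨hs', hsI⟩)

end ArcCosts

namespace IsMaxPartition

variable {c : ℕ → ℝ → ℝ → ℝ} {α : ℕ → ℝ} {h ε δ T τ : ℝ} {N : ℕ} {t : ℕ → ℝ}

lemma cost_add_cost_le (ht : IsMaxPartition c N h τ t) {s : ℕ → ℝ} (hs : Admissible N h τ s)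
    {i j : ℕ} (hi : i < N) (hj : j < N) (hij : i ≠ j)
    (hst : ∀ l < N, l ≠ i → l ≠ j → c l (s l) (s (l + 1)) = c l (t l) (t (l + 1))) :
    c i (s i) (s (i + 1)) + c j (s j) (s (j + 1)) ≤
      c i (t i) (t (i + 1)) + c j (t j) (t (j + 1)) := by
  have hsum := Finset.sum_eq_add_of_mem
    (f := fun l => c l (s l) (s (l + 1)) - c l (t l) (t (l + 1))) i j
    (Finset.mem_range.2 hi) (Finset.mem_range.2 hj) hij
    fun l hl hne => sub_eq_zero.2 (hst l (Finset.mem_range.1 hl) hne.1 hne.2)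
  rw [Finset.sum_sub_distrib] at hsum
  have hmax := ht.totalCost_le s hs
  unfold totalCost at hmax
  linarith

lemma transfer_le (ht : IsMaxPartition c N h τ t) (hc : ArcCosts c α h ε δ T) {i j : ℕ}
    (hi : i < N) (hj : j < N) (hij : i ≠ j) {z : ℤ} (hz : 0 ≤ z * T)
    (hgap : h ≤ t (j + 1) - (t j + z * T)) :
    c i (t i) (t (i + 1) + z * T) + c j (t j + z * T) (t (j + 1)) ≤
      c i (t i) (t (i + 1)) + c j (t j) (t (j + 1)) := by
  set σ : ℕ → ℤ := fun l => (if i < l then 1 else 0) - if j < l then 1 else 0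
  set s : ℕ → ℝ := fun l => t l + (σ l * z : ℤ) * T
  have hσ : ∀ l, l ≠ i → l ≠ j → σ (l + 1) = σ l := fun l hli hlj => by grind
  have hσi : σ (i + 1) = σ i + 1 := by grind
  have hσj : σ (j + 1) = σ j - 1 := by grind
  have hs_gap : ∀ l < N, h ≤ s (l + 1) - s l := fun l hl => by
    have hgap_l := ht.admissible.le_gap l hl
    rcases eq_or_ne l i with rfl | hli
    · simp only [s, hσi]; push_cast; linarith
    rcases eq_or_ne l j with rfl | hlj
    · simp only [s, hσj]; push_cast; linarith
    simp only [s, hσ l hli hlj]; linarith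
  have key := ht.cost_add_cost_le ⟨?_, hs_gap⟩ hi hj hij fun l hl hli hlj => ?_
  · have hi_cost : c i (s i) (s (i + 1)) = c i (t i) (t (i + 1) + z * T) := by
      rw [← hc.translate i (t i) _ (by linarith [ht.admissible.le_gap i hi]) (σ i * z)]
      simp only [s, hσi]; push_cast; ring_nf
    have hj_cost : c j (s j) (s (j + 1)) = c j (t j + z * T) (t (j + 1)) := by
      rw [← hc.translate j (t j + z * T) _ hgap (σ (j + 1) * z)]
      simp only [s, hσj]; push_cast; ring_nf
    rwa [hi_cost, hj_cost] at key
  · have hσ0 : σ 0 = 0 := by grind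
    have hσN : σ N = 0 := by grind
    simp only [s, hσ0, hσN, ht.admissible.last]
    simp
  · simp only [s, hσ l hli hlj]
    exact hc.translate l _ _ (ht.admissible.le_gap l hl) _

theorem gap_lt_of_gap_eq (ht : IsMaxPartition c N h τ t) (hc : ArcCosts c α h ε δ T) {i j : ℕ}
    (hi : i < N) (hj : j < N) (hshort : t (i + 1) - t i = h) :
    t (j + 1) - t j < (T + h) / δ := by
  by_contra! hlong
  set X := t (j + 1) - t j with hX
  have hT := hc.period_pos
  have hh := hc.h_pos
  have hδ := hc.δ_pos
  have hδX : T + h ≤ δ * X := by rwa [div_le_iff₀' hδ] at hlong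
  have hX0 : 0 < X := pos_of_mul_pos_right (by linarith) hδ.le
  have hδ3 : δ * X ≤ X / 3 := by linarith [mul_le_mul_of_nonneg_right hc.δ_le hX0.le]
  have hij : i ≠ j := by
    rintro rfl
    linarith
  obtain ⟨z, hz⟩ : ∃ z : ℤ, z * T ∈ Icc (δ * X) (2 * (δ * X)) := by
    refine ⟨⌈δ * X / T⌉, (div_le_iff₀ hT).1 (Int.le_ceil _), ?_⟩
    have hceil := mul_lt_mul_of_pos_right (Int.ceil_lt_add_one (δ * X / T)) hT
    rw [add_mul, div_mul_cancel₀ _ hT.ne'] at hceil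
    linarith
  have hgap_i : h ≤ t (i + 1) + z * T - t i := by linarith [hz.1]
  have hgap_j : h ≤ t (j + 1) - (t j + z * T) := by linarith [hz.2]
  have hmax := ht.transfer_le hc hi hj hij (by linarith [hz.1]) hgap_j
  have hcubes : (α j - ε) * X ^ 3 ≤
      (α j + ε) * ((1 - δ) * X) ^ 3 + (α i + ε) * (3 * δ * X) ^ 3 := by
    have hpos : ∀ l, 0 ≤ α l + ε := fun l => by linarith [neg_le_of_abs_le (hc.abs_ε_le l)]
    have hnew_i : (α i + ε) * (t (i + 1) + z * T - t i) ^ 3 ≤ (α i + ε) * (3 * δ * X) ^ 3 :=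
      mul_le_mul_of_nonneg_left
        (pow_le_pow_left₀ (by linarith) (by linarith [hz.2]) 3) (hpos i)
    have hnew_j : (α j + ε) * (t (j + 1) - (t j + z * T)) ^ 3 ≤ (α j + ε) * ((1 - δ) * X) ^ 3 :=
      mul_le_mul_of_nonneg_left
        (pow_le_pow_left₀ (by linarith) (by linarith [hz.1]) 3) (hpos j)
    linarith [hc.le_cost hgap_i i, hc.le_cost hgap_j j,
      hc.cost_nonpos (ht.admissible.le_gap i hi) i, hc.cost_le (ht.admissible.le_gap j hj) j]
  linarith [mul_lt_mul_of_pos_right (hc.exchange i j) (pow_pos hX0 3)]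

theorem lt_gap (ht : IsMaxPartition c N h τ t) (hc : ArcCosts c α h ε δ T)
    (hτ : N * ((T + h) / δ) ≤ τ) {i : ℕ} (hi : i < N) : h < t (i + 1) - t i := by
  refine (ht.admissible.le_gap i hi).lt_of_ne' fun hshort => hτ.not_gt ?_
  calc τ = ∑ j ∈ Finset.range N, (t (j + 1) - t j) := by
        rw [Finset.sum_range_sub, ht.admissible.last, add_sub_cancel_left]
    _ < ∑ _j ∈ Finset.range N, (T + h) / δ :=
        Finset.sum_lt_sum_of_nonempty ⟨i, Finset.mem_range.2 hi⟩
          fun j hj => ht.gap_lt_of_gap_eq hc hi (Finset.mem_range.1 hj) hshort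
    _ = N * ((T + h) / δ) := by rw [Finset.sum_const, Finset.card_range, nsmul_eq_mul]

lemma isLocalMax_interior (ht : IsMaxPartition c N h τ t) {i : ℕ} (hi : i + 1 < N)
    (hgap : ∀ l < N, h < t (l + 1) - t l) :
    IsLocalMax (fun s => c i (t i) s + c (i + 1) s (t (i + 2))) (t (i + 1)) := by
  have hl := hgap i (by omega)
  have hr := hgap (i + 1) hi
  filter_upwards [Ioo_mem_nhds (show t i + h < t (i + 1) by linarith)
    (show t (i + 1) < t (i + 2) - h by linarith)] with s hs
  have hupd : ∀ l, l ≠ i + 1 → Function.update t (i + 1) s l = t l := fun l hl =>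
    Function.update_of_ne hl s t
  have key := ht.cost_add_cost_le (s := Function.update t (i + 1) s) ⟨?_, fun l hl => ?_⟩
    (show i < N by omega) hi (by omega) fun l _ hli hlj => ?_
  · simpa using key
  · rw [hupd N (by omega), hupd 0 (by omega)]
    exact ht.admissible.last
  · rcases eq_or_ne l i with rfl | hli
    · rw [Function.update_self, hupd l (by omega)]
      linarith [hs.1]
    · rcases eq_or_ne l (i + 1) with rfl | hlj
      · rw [Function.update_self, hupd (i + 1 + 1) (by omega)]
        linarith [hs.2]
      · rw [hupd l hlj, hupd (l + 1) (by omega)]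
        exact ht.admissible.le_gap l hl
  · rw [hupd l hlj, hupd (l + 1) (by omega)]

lemma isLocalMax_ends (ht : IsMaxPartition c (N + 1) h τ t) (hN : 0 < N)
    (hgap : ∀ l < N + 1, h < t (l + 1) - t l) :
    IsLocalMax (fun s => c N (t N) (s + τ) + c 0 s (t 1)) (t 0) := by
  have hl := hgap N (by omega)
  have hr := hgap 0 (by omega)
  have hlast := ht.admissible.last
  rw [zero_add] at hr
  filter_upwards [Ioo_mem_nhds (show t N + h - τ < t 0 by linarith)
    (show t 0 < t 1 - h by linarith)] with s hs
  set r := Function.update (Function.update t 0 s) (N + 1) (s + τ) with hrdef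
  have hr0 : r 0 = s := by rw [hrdef, Function.update_of_ne (by omega), Function.update_self]
  have hrN : r (N + 1) = s + τ := by rw [hrdef, Function.update_self]
  have hrl : ∀ l, l ≠ 0 → l ≠ N + 1 → r l = t l := fun l h0 h1 => by
    rw [hrdef, Function.update_of_ne h1, Function.update_of_ne h0]
  have key := ht.cost_add_cost_le (s := r) ⟨by rw [hrN, hr0], fun l hl => ?_⟩
    (show N < N + 1 by omega) (show 0 < N + 1 by omega) hN.ne' fun l hl hlN hl0 => ?_
  · rw [hrN, hr0, hrl N (by omega) (by omega), zero_add, hrl 1 (by omega) (by omega)] at key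
    rwa [hlast] at key
  · rcases eq_or_ne l 0 with rfl | hl0
    · rw [hr0, zero_add, hrl 1 (by omega) (by omega)]
      linarith [hs.2]
    · rw [hrl l hl0 (by omega)]
      rcases eq_or_ne l N with rfl | hlN
      · rw [hrN]
        linarith [hs.1]
      · rw [hrl (l + 1) (by omega) (by omega)]
        exact ht.admissible.le_gap l hl
  · rw [hrl l hl0 (by omega), hrl (l + 1) (by omega) (by omega)]

end IsMaxPartition

section Gluing

variable {f : ℝ → ℝ → ℝ} {K : ℝ≥0} {M : ℝ}

lemma eqOn_pieces (hl : ∀ t, LipschitzWith K (f t)) {N : ℕ} {t : ℕ → ℝ} {w : ℕ → ℝ → ℝ × ℝ}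
    {β : ℝ → ℝ × ℝ} (hβ : ∀ s, HasDerivAt β (phaseField f s (β s)) s) (hβ₀ : β (t 0) = w 0 (t 0))
    (hle : ∀ i < N, t i ≤ t (i + 1))
    (hw : ∀ i < N, ∀ s ∈ Icc (t i) (t (i + 1)), HasDerivAt (w i) (phaseField f s (w i s)) s)
    (hmatch : ∀ i, i + 1 < N → w i (t (i + 1)) = w (i + 1) (t (i + 1))) :
    ∀ i < N, EqOn β (w i) (Icc (t i) (t (i + 1))) := by
  intro i hi
  refine phaseField_curve_eqOn_Icc hl (fun s _ => hβ s) (hw i hi) ?_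
  induction i with
  | zero => exact hβ₀
  | succ i ih =>
    have hprev := phaseField_curve_eqOn_Icc hl (fun s _ => hβ s) (hw i (by omega)) (ih (by omega))
    rw [hprev (right_mem_Icc.2 (hle i (by omega))), hmatch i hi]

theorem exists_periodic_curve_of_pieces (hc : ∀ x, Continuous fun t => f t x)
    (hl : ∀ t, LipschitzWith K (f t)) (hb : ∀ t x, |f t x| ≤ M) {τ : ℝ}
    (hf : Function.Periodic f τ) {N : ℕ} {t : ℕ → ℝ} {w : ℕ → ℝ → ℝ × ℝ}
    (hle : ∀ i < N + 1, t i ≤ t (i + 1)) (hlast : t (N + 1) = t 0 + τ)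
    (hw : ∀ i < N + 1, ∀ s ∈ Icc (t i) (t (i + 1)), HasDerivAt (w i) (phaseField f s (w i s)) s)
    (hmatch : ∀ i < N, w i (t (i + 1)) = w (i + 1) (t (i + 1)))
    (hclose : w N (t 0 + τ) = w 0 (t 0)) :
    ∃ β : ℝ → ℝ × ℝ, (∀ s, HasDerivAt β (phaseField f s (β s)) s) ∧ Function.Periodic β τ ∧
      ∀ i < N + 1, EqOn β (w i) (Icc (t i) (t (i + 1))) := by
  obtain ⟨β, hβ₀, hβ⟩ := exists_phaseField_curve hc hl hb (t 0) (w 0 (t 0))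
  have heq := eqOn_pieces hl hβ hβ₀ hle hw fun i hi => hmatch i (by omega)
  have hβτ : β (t 0 + τ) = β (t 0) := by
    rw [← hlast, heq N N.lt_succ_self (right_mem_Icc.2 (hle N N.lt_succ_self)), hlast, hclose, hβ₀]
  refine ⟨β, hβ, congrFun (phaseField_curve_unique hl (t₀ := t 0) (fun s => ?_) hβ hβτ), heq⟩
  exact ((hβ (s + τ)).comp_add_const s τ).congr_deriv (by simp only [phaseField, hf s])

end Gluing

lemma IsMotionOn.neg {g p u v : ℝ → ℝ} {s : Set ℝ} (h : IsMotionOn g p s u v) :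
    IsMotionOn (fun x => -g (-x)) (fun t => -p t) s (fun t => -u t) (fun t => -v t) where
  deriv_fst t := (h.deriv_fst t).neg
  cont := h.cont.neg
  deriv_snd t ht := (h.deriv_snd t ht).neg.congr_deriv (by rw [neg_neg]; ring)

namespace IsArc

variable {g p u v : ℝ → ℝ} {κ a b : ℝ}

lemma left_velocity_nonneg (h : IsArc g p κ a b u v) (hκ : 0 ≤ κ) (hab : a < b) : 0 ≤ v a := by
  have hslope : Tendsto (slope u a) (𝓝[>] a) (𝓝 (v a)) :=
    (hasDerivWithinAt_iff_tendsto_slope' self_notMem_Ioi).1 (h.deriv_fst a).hasDerivWithinAt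
  refine ge_of_tendsto hslope ?_
  filter_upwards [Ioo_mem_nhdsGT hab] with s hs
  rw [slope_def_field, h.left, sub_zero]
  exact div_nonneg (h.nonneg hκ (Ioo_subset_Icc_self hs)) (sub_nonneg.2 hs.1.le)

lemma right_velocity_nonpos (h : IsArc g p κ a b u v) (hκ : 0 ≤ κ) (hab : a < b) : v b ≤ 0 := by
  simpa only [neg_neg, neg_nonneg] using h.comp_neg.left_velocity_nonneg hκ (neg_lt_neg hab)

end IsArc

/-- Arcs of alternating sign: positive for even index, negative for odd index, a negative arc being
encoded as the opposite of a positive arc for the reflected force `s ↦ -g (-s)` and forcing `-p`. -/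
def IsSignedArc (g p : ℝ → ℝ) (κ κ' : ℝ) (i : ℕ) (a b : ℝ) (u v : ℝ → ℝ) : Prop :=
  if Even i then IsArc g p κ a b u v
  else IsArc (fun s => -g (-s)) (fun t => -p t) κ' a b (fun t => -u t) (fun t => -v t)

/-- The action of the arc of sign `(-1) ^ i`, as a function of its ends. -/
noncomputable def signedAction (g p : ℝ → ℝ) (κ κ' : ℝ) (i : ℕ) : ℝ → ℝ → ℝ :=
  if Even i then arcAction g p κ else arcAction (fun s => -g (-s)) (fun t => -p t) κ'

namespace IsSignedArc

variable {g p u v : ℝ → ℝ} {κ κ' a b : ℝ} {i : ℕ}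

lemma isMotionOn (h : IsSignedArc g p κ κ' i a b u v) : IsMotionOn g p (Icc a b) u v := by
  unfold IsSignedArc at h
  split_ifs at h
  · exact h.toIsMotionOn
  · simpa only [neg_neg] using h.toIsMotionOn.neg

lemma left (h : IsSignedArc g p κ κ' i a b u v) : u a = 0 := by
  unfold IsSignedArc at h
  split_ifs at h
  · exact h.left
  · exact neg_eq_zero.1 h.left

lemma right (h : IsSignedArc g p κ κ' i a b u v) : u b = 0 := by
  unfold IsSignedArc at h
  split_ifs at h
  · exact h.right
  · exact neg_eq_zero.1 h.right

lemma ne_zero (h : IsSignedArc g p κ κ' i a b u v) (hκ : 0 < κ) (hκ' : 0 < κ') {t : ℝ}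
    (ht : t ∈ Ioo a b) : u t ≠ 0 := by
  unfold IsSignedArc at h
  split_ifs at h
  · exact (h.pos hκ ht).ne'
  · exact (neg_pos.1 (h.pos hκ' ht)).ne

lemma left_velocity (h : IsSignedArc g p κ κ' i a b u v) (hκ : 0 ≤ κ) (hκ' : 0 ≤ κ')
    (hab : a < b) : 0 ≤ (-1) ^ i * v a := by
  unfold IsSignedArc at h
  split_ifs at h with hi
  · rw [hi.neg_one_pow, one_mul]
    exact h.left_velocity_nonneg hκ hab
  · rw [(Nat.not_even_iff_odd.1 hi).neg_one_pow, neg_one_mul]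
    exact h.left_velocity_nonneg hκ' hab

lemma right_velocity (h : IsSignedArc g p κ κ' i a b u v) (hκ : 0 ≤ κ) (hκ' : 0 ≤ κ')
    (hab : a < b) : (-1) ^ i * v b ≤ 0 := by
  unfold IsSignedArc at h
  split_ifs at h with hi
  · rw [hi.neg_one_pow, one_mul]
    exact h.right_velocity_nonpos hκ hab
  · rw [(Nat.not_even_iff_odd.1 hi).neg_one_pow, neg_one_mul]
    exact h.right_velocity_nonpos hκ' hab

end IsSignedArc

/-- The force and the forcing satisfy the standing assumptions on both half-lines: `G` is the limit
of the force at `+∞` and `-G'` its limit at `-∞`, so that the mean `m` lies between `-G'` and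
`G`. -/
structure TwoSidedForce (g p : ℝ → ℝ) (m G G' M B : ℝ) (K : ℝ≥0) : Prop where
  pos : OneSidedForce g p m G M B K
  neg : OneSidedForce (fun s => -g (-s)) (fun t => -p t) (-m) G' M B K

lemma exists_exchange_constants {lo hi : ℝ} (hlo : 0 < lo) (hlohi : lo ≤ hi) :
    ∃ ε δ : ℝ, 0 < ε ∧ ε ≤ lo ∧ 0 < δ ∧ δ ≤ 1 / 3 ∧ ∀ x ∈ Icc lo hi, ∀ y ∈ Icc lo hi,
      (y + ε) * (1 - δ) ^ 3 + (x + ε) * (3 * δ) ^ 3 < y - ε := by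
  have hhi : 0 < hi := hlo.trans_le hlohi
  set δ := lo / hi / 16 with hδdef
  have hδ : 0 < δ := by positivity
  have hδ16 : δ ≤ 1 / 16 := by
    linarith [(div_le_one hhi).2 hlohi]
  have hδhi : hi * δ = lo / 16 := by
    rw [hδdef]; field_simp
  refine ⟨δ * lo / 10, δ, by positivity, by nlinarith, hδ, by linarith, fun x hx y hy => ?_⟩
  set ε := δ * lo / 10 with hεdef
  have hε : 0 < ε := by positivity
  have hlong : (y + ε) * (1 - δ) ^ 3 ≤ (y + ε) * (1 - δ) :=
    mul_le_mul_of_nonneg_left (pow_le_of_le_one (by linarith) (by linarith) three_ne_zero)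
      (by linarith [hy.1])
  have hshort : (x + ε) * (3 * δ) ^ 3 ≤ 27 / 128 * (lo * δ) := by
    have hsq : δ ^ 2 ≤ 1 / 16 * δ := by rw [sq]; gcongr
    calc (x + ε) * (3 * δ) ^ 3 ≤ (hi + hi) * (3 * δ) ^ 3 := by
          gcongr
          · exact hx.2
          · nlinarith
      _ = 54 * (hi * δ) * δ ^ 2 := by ring
      _ ≤ 54 * (lo / 16) * (1 / 16 * δ) := by rw [hδhi]; gcongr
      _ = 27 / 128 * (lo * δ) := by ring
  have hyδ : lo * δ ≤ y * δ := mul_le_mul_of_nonneg_right hy.1 hδ.le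
  nlinarith [mul_pos hε hδ, mul_pos hlo hδ]

namespace TwoSidedForce

variable {g p u v u' v' : ℝ → ℝ} {m G G' M B h₀ a b c d τ : ℝ} {K : ℝ≥0} {i j : ℕ}

lemma exists_signedArc (hf : TwoSidedForce g p m G G' M B K) (hL : LongEnough g m G B (b - a))
    (hL' : LongEnough (fun s => -g (-s)) (-m) G' B (b - a)) (i : ℕ) :
    ∃ u v, IsSignedArc g p ((G - m) / 4) ((G' - -m) / 4) i a b u v := by
  unfold IsSignedArc
  split_ifs
  · exact hf.pos.exists_arc hL
  · obtain ⟨u, v, h⟩ := hf.neg.exists_arc hL'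
    exact ⟨fun t => -u t, fun t => -v t, by simpa only [neg_neg] using h⟩

lemma hasDerivAt_signedAction_right (hf : TwoSidedForce g p m G G' M B K)
    (hL : ∀ L, h₀ ≤ L → LongEnough g m G B L)
    (hL' : ∀ L, h₀ ≤ L → LongEnough (fun s => -g (-s)) (-m) G' B L) (h1 : 1 ≤ h₀)
    (hab : h₀ < b - a) (hu : IsSignedArc g p ((G - m) / 4) ((G' - -m) / 4) i a b u v) :
    HasDerivAt (fun s => signedAction g p ((G - m) / 4) ((G' - -m) / 4) i a s)
      (-(v b ^ 2 / 2)) b := by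
  unfold IsSignedArc at hu
  unfold signedAction
  split_ifs at hu ⊢
  · exact hf.pos.hasDerivAt_arcAction_right hL h1 hab hu
  · simpa only [neg_sq] using hf.neg.hasDerivAt_arcAction_right hL' h1 hab hu

lemma hasDerivAt_signedAction_left (hf : TwoSidedForce g p m G G' M B K)
    (hL : ∀ L, h₀ ≤ L → LongEnough g m G B L)
    (hL' : ∀ L, h₀ ≤ L → LongEnough (fun s => -g (-s)) (-m) G' B L) (h1 : 1 ≤ h₀)
    (hab : h₀ < b - a) (hu : IsSignedArc g p ((G - m) / 4) ((G' - -m) / 4) i a b u v) :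
    HasDerivAt (fun s => signedAction g p ((G - m) / 4) ((G' - -m) / 4) i s b)
      (v a ^ 2 / 2) a := by
  unfold IsSignedArc at hu
  unfold signedAction
  split_ifs at hu ⊢
  · exact hf.pos.hasDerivAt_arcAction_left hL h1 hab hu
  · simpa only [neg_sq] using hf.neg.hasDerivAt_arcAction_left hL' h1 hab hu

-- Criticality gives equal speeds, and both velocities point to the side of the second arc.
theorem velocity_eq_of_isLocalMax (hf : TwoSidedForce g p m G G' M B K)
    (hL : ∀ L, h₀ ≤ L → LongEnough g m G B L)
    (hL' : ∀ L, h₀ ≤ L → LongEnough (fun s => -g (-s)) (-m) G' B L) (h1 : 1 ≤ h₀)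
    (hij : Odd (i + j)) (hab : h₀ < c + τ - a) (hcd : h₀ < d - c)
    (hu : IsSignedArc g p ((G - m) / 4) ((G' - -m) / 4) i a (c + τ) u v)
    (hu' : IsSignedArc g p ((G - m) / 4) ((G' - -m) / 4) j c d u' v')
    (hmax : IsLocalMax (fun s => signedAction g p ((G - m) / 4) ((G' - -m) / 4) i a (s + τ) +
      signedAction g p ((G - m) / 4) ((G' - -m) / 4) j s d) c) : v (c + τ) = v' c := by
  have hκ : 0 ≤ (G - m) / 4 := by linarith [hf.pos.gap_pos]
  have hκ' : 0 ≤ (G' - -m) / 4 := by linarith [hf.neg.gap_pos]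
  have hspeed : v (c + τ) ^ 2 = v' c ^ 2 := by
    have hcrit := hmax.hasDerivAt_eq_zero
      (((hf.hasDerivAt_signedAction_right hL hL' h1 hab hu).comp_add_const c τ).add
        (hf.hasDerivAt_signedAction_left hL hL' h1 hcd hu'))
    linarith
  have hright := hu.right_velocity hκ hκ' (by linarith)
  have hleft := hu'.left_velocity hκ hκ' (by linarith)
  have hsign : (-1 : ℝ) ^ j = -(-1) ^ i := by
    rw [← mul_left_inj' (pow_ne_zero i (by norm_num : (-1 : ℝ) ≠ 0)), ← pow_add, add_comm j,
      hij.neg_one_pow, neg_mul, ← pow_add, (Even.add_self i).neg_one_pow]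
  rw [hsign] at hleft
  rcases neg_one_pow_eq_or ℝ i with hi | hi <;> rw [hi] at hright hleft <;>
    rcases sq_eq_sq_iff_eq_or_eq_neg.1 hspeed with h | h <;> linarith

theorem exists_arcCosts (hf : TwoSidedForce g p m G G' M B K) :
    ∃ (α : ℕ → ℝ) (h₀ ε δ : ℝ), 1 ≤ h₀ ∧
      (∀ L, h₀ ≤ L → LongEnough g m G B L) ∧
      (∀ L, h₀ ≤ L → LongEnough (fun s => -g (-s)) (-m) G' B L) ∧
      ∀ T, 0 < T → Function.Periodic p T →
        ArcCosts (signedAction g p ((G - m) / 4) ((G' - -m) / 4)) α (h₀ + 1) ε δ T := by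
  set α₀ := (G - m) ^ 2 / 24
  set α₁ := (G' - -m) ^ 2 / 24
  have hα₀ : 0 < α₀ := div_pos (pow_pos hf.pos.gap_pos 2) (by norm_num)
  have hα₁ : 0 < α₁ := div_pos (pow_pos hf.neg.gap_pos 2) (by norm_num)
  obtain ⟨ε, δ, hε, hεlo, hδ, hδ3, hexchange⟩ :=
    exists_exchange_constants (lt_min hα₀ hα₁) (min_le_max (a := α₀) (b := α₁))
  set α : ℕ → ℝ := fun i => if Even i then α₀ else α₁
  have hα : ∀ i, α i ∈ Icc (min α₀ α₁) (max α₀ α₁) := fun i => by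
    simp only [α]
    split_ifs
    exacts [⟨min_le_left _ _, le_max_left _ _⟩, ⟨min_le_right _ _, le_max_right _ _⟩]
  obtain ⟨h₀, hh₀⟩ := eventually_atTop.1 ((hf.pos.eventually_longEnough.and
    hf.neg.eventually_longEnough).and ((hf.pos.eventually_abs_arcAction_add_le hε).and
    (hf.neg.eventually_abs_arcAction_add_le hε)))
  have hL : ∀ L, max h₀ 1 ≤ L → LongEnough g m G B L := fun L hL =>
    (hh₀ L ((le_max_left _ _).trans hL)).1.1
  have hL' : ∀ L, max h₀ 1 ≤ L → LongEnough (fun s => -g (-s)) (-m) G' B L := fun L hL =>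
    (hh₀ L ((le_max_left _ _).trans hL)).1.2
  have h1 : 1 ≤ max h₀ 1 := le_max_right _ _
  refine ⟨α, max h₀ 1, ε, δ, h1, hL, hL', fun T hT hp => ⟨hT, by linarith, hδ, hδ3,
    fun i => (abs_of_pos hε).trans_le (hεlo.trans (hα i).1),
    fun i j => hexchange _ (hα i) _ (hα j), fun i a b hab z => ?_, fun i a b hab => ?_,
    fun i a b hab => ?_⟩⟩
  · have hz := hp.int_mul z
    unfold signedAction
    split_ifs
    · exact hf.pos.arcAction_translate (hL _ (by linarith)) hz
    · exact hf.neg.arcAction_translate (hL' _ (by linarith)) fun t => by simp only [hz t]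
  · unfold signedAction
    split_ifs
    · exact hf.pos.continuousAt_arcAction hL h1 (by linarith)
    · exact hf.neg.continuousAt_arcAction hL' h1 (by linarith)
  · have hasymp := (hh₀ (b - a) (by linarith [le_max_left h₀ 1])).2
    simp only [signedAction, α]
    split_ifs
    · exact hasymp.1 a b rfl
    · exact hasymp.2 a b rfl

lemma exists_periodic_solution_of_isMaxPartition (hf : TwoSidedForce g p m G G' M B K)
    (hL : ∀ L, h₀ ≤ L → LongEnough g m G B L)
    (hL' : ∀ L, h₀ ≤ L → LongEnough (fun s => -g (-s)) (-m) G' B L) (h1 : 1 ≤ h₀) {h : ℝ}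
    (hh : h₀ ≤ h) (hp : Function.Periodic p τ) {N : ℕ} (hN : Odd N) {t : ℕ → ℝ}
    (ht : IsMaxPartition (signedAction g p ((G - m) / 4) ((G' - -m) / 4)) (N + 1) h τ t)
    (hgap : ∀ i < N + 1, h < t (i + 1) - t i) :
    ∃ u v : ℝ → ℝ, (∀ s, HasDerivAt u (v s) s) ∧ (∀ s, HasDerivAt v (p s - g (u s)) s) ∧
      Function.Periodic u τ ∧
      ∀ i < N + 1, u (t i) = 0 ∧ ∀ s ∈ Ioo (t i) (t (i + 1)), u s ≠ 0 := by
  have hlong : ∀ i < N + 1, h₀ < t (i + 1) - t i := fun i hi => hh.trans_lt (hgap i hi)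
  have hle : ∀ i < N + 1, t i ≤ t (i + 1) := fun i hi => by linarith [hlong i hi]
  have hlast := ht.admissible.last
  have harcs : ∀ i, ∃ u v, i < N + 1 →
      IsSignedArc g p ((G - m) / 4) ((G' - -m) / 4) i (t i) (t (i + 1)) u v := fun i => by
    by_cases hi : i < N + 1
    · obtain ⟨u, v, hu⟩ := hf.exists_signedArc (hL _ (hlong i hi).le) (hL' _ (hlong i hi).le) i
      exact ⟨u, v, fun _ => hu⟩
    · exact ⟨0, 0, fun hi' => absurd hi' hi⟩
  choose w z hw using harcs
  have hmatch : ∀ i < N, z i (t (i + 1)) = z (i + 1) (t (i + 1)) := fun i hi => by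
    have hi' : i + 1 < N + 1 := by omega
    have hmax := ht.isLocalMax_interior hi' hgap
    simpa only [add_zero] using hf.velocity_eq_of_isLocalMax (τ := 0) hL hL' h1
      ⟨i, by ring⟩ (by simpa only [add_zero] using hlong i (by omega)) (hlong (i + 1) hi')
      (by simpa only [add_zero] using hw i (by omega)) (hw (i + 1) hi')
      (by simpa only [add_zero] using hmax)
  have hclose : z N (t 0 + τ) = z 0 (t 0) :=
    hf.velocity_eq_of_isLocalMax (i := N) (j := 0) hL hL' h1 hN (hlast ▸ hlong N N.lt_succ_self)
      (hlong 0 N.succ_pos) (hlast ▸ hw N N.lt_succ_self) (hw 0 N.succ_pos)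
      (ht.isLocalMax_ends hN.pos hgap)
  have hpc := hf.pos.cont
  obtain ⟨β, hβ, hβτ, heq⟩ := exists_periodic_curve_of_pieces (f := fun s x => p s - g x)
    (w := fun i s => (w i s, z i s)) (fun x => by fun_prop)
    (fun s => by simpa only [zero_add] using (LipschitzWith.const (p s)).sub hf.pos.lip)
    hf.pos.abs_accel_le (fun s => by simp only [hp s]) hle hlast
    (fun i hi s hs =>
      ((hw i hi).isMotionOn.deriv_fst s).prodMk ((hw i hi).isMotionOn.deriv_snd s hs))
    (fun i hi => by
      rw [(hw i (by omega)).right, (hw (i + 1) (by omega)).left, hmatch i hi])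
    (by rw [(hw 0 N.succ_pos).left, hclose, ← hlast, (hw N N.lt_succ_self).right])
  refine ⟨fun s => (β s).1, fun s => (β s).2, fun s => hasDerivAt_fst_comp (hβ s),
    fun s => hasDerivAt_snd_comp (hβ s), fun s => congrArg Prod.fst (hβτ s), fun i hi => ⟨?_, ?_⟩⟩
  · simpa only [heq i hi (left_mem_Icc.2 (hle i hi))] using (hw i hi).left
  · intro s hs
    simp only [heq i hi (Ioo_subset_Icc_self hs)]
    exact (hw i hi).ne_zero (by linarith [hf.pos.gap_pos]) (by linarith [hf.neg.gap_pos]) hs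

theorem exists_periodic_solution (hf : TwoSidedForce g p m G G' M B K) {T : ℝ} (hT : 0 < T)
    (hp : Function.Periodic p T) :
    ∃ H : ℝ, 0 < H ∧ ∀ τ, Function.Periodic p τ → ∀ N : ℕ, Odd N → H * (N + 1) ≤ τ →
      ∃ (u v : ℝ → ℝ) (t : ℕ → ℝ), (∀ s, HasDerivAt u (v s) s) ∧
        (∀ s, HasDerivAt v (p s - g (u s)) s) ∧ Function.Periodic u τ ∧
        t (N + 1) = t 0 + τ ∧ ∀ i < N + 1, t i < t (i + 1) ∧ u (t i) = 0 ∧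
          ∀ s ∈ Ioo (t i) (t (i + 1)), u s ≠ 0 := by
  obtain ⟨α, h₀, ε, δ, h1, hL, hL', hcosts⟩ := hf.exists_arcCosts
  have hc := hcosts T hT hp
  have hδ := hc.δ_pos
  have hδ3 := hc.δ_le
  have hH : h₀ + 1 ≤ (T + (h₀ + 1)) / δ := by
    rw [le_div_iff₀ hδ]
    nlinarith
  refine ⟨(T + (h₀ + 1)) / δ, by positivity, fun τ hτ N hN hlong => ?_⟩
  have hlong' : ((N + 1 : ℕ) : ℝ) * ((T + (h₀ + 1)) / δ) ≤ τ := by push_cast; linarith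
  obtain ⟨t, ht⟩ := hc.exists_isMaxPartition N.succ_pos
    ((mul_le_mul_of_nonneg_left hH (Nat.cast_nonneg _)).trans hlong')
  have hgap : ∀ i < N + 1, h₀ + 1 < t (i + 1) - t i := fun i hi => ht.lt_gap hc hlong' hi
  obtain ⟨u, v, hu, hv, huτ, hzero⟩ :=
    hf.exists_periodic_solution_of_isMaxPartition hL hL' h1 (by linarith) hτ hN ht hgap
  exact ⟨u, v, t, hu, hv, huτ, ht.admissible.last, fun i hi =>
    ⟨by linarith [hgap i hi], hzero i hi⟩⟩

end TwoSidedForce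

section StandingAssumptions

variable {g p : ℝ → ℝ} {gminus gplus T : ℝ} {K : ℝ≥0}

lemma exists_deriv_le_of_concaveOn (hg : ContDiff ℝ 1 g) (hconc : ConcaveOn ℝ (Ioi 0) g) :
    ∃ C, ∀ x, 0 ≤ x → deriv g x ≤ C := by
  have hanti := hconc.antitoneOn_deriv fun x _ => hg.differentiable one_ne_zero x
  obtain ⟨C, hC⟩ := (isCompact_Icc (a := (0 : ℝ)) (b := 1)).bddAbove_image
    (hg.continuous_deriv le_rfl).continuousOn
  refine ⟨C, fun x hx => ?_⟩
  rcases le_total x 1 with h | h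
  · exact hC (mem_image_of_mem _ ⟨hx, h⟩)
  · exact (hanti (mem_Ioi.2 one_pos) (mem_Ioi.2 (one_pos.trans_le h)) h).trans
      (hC (mem_image_of_mem _ ⟨zero_le_one, le_rfl⟩))

lemma concaveOn_neg_comp_neg (hconv : ConvexOn ℝ (Iio 0) g) :
    ConcaveOn ℝ (Ioi 0) fun s => -g (-s) := by
  convert! (hconv.comp_linearMap (-LinearMap.id)).neg using 1
  ext
  simp

lemma exists_lipschitzWith_of_concaveOn_of_convexOn (hg : ContDiff ℝ 1 g) (hmono : Monotone g)
    (hconc : ConcaveOn ℝ (Ioi 0) g) (hconv : ConvexOn ℝ (Iio 0) g) :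
    ∃ K : ℝ≥0, LipschitzWith K g := by
  obtain ⟨C, hC⟩ := exists_deriv_le_of_concaveOn hg hconc
  obtain ⟨C', hC'⟩ : ∃ C', ∀ x, 0 ≤ x → deriv (fun s => -g (-s)) x ≤ C' :=
    exists_deriv_le_of_concaveOn (hg.comp contDiff_neg).neg (concaveOn_neg_comp_neg hconv)
  have hreflect : ∀ x, deriv (fun s => -g (-s)) x = deriv g (-x) := fun x => by
    rw [deriv.fun_neg, deriv_comp_neg, neg_neg]
  refine ⟨(max C C').toNNReal,
    lipschitzWith_of_nnnorm_deriv_le (hg.differentiable one_ne_zero) fun x => ?_⟩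
  rw [Real.nnnorm_of_nonneg hmono.deriv_nonneg, ← NNReal.coe_le_coe, NNReal.coe_mk]
  refine le_trans ?_ (Real.le_coe_toNNReal _)
  rcases le_total 0 x with h | h
  · exact (hC x h).trans (le_max_left _ _)
  · have hx := hC' (-x) (neg_nonneg.2 h)
    rw [hreflect, neg_neg] at hx
    exact hx.trans (le_max_right _ _)

lemma IsSaturatingForce.exists_lipschitzWith (hg : IsSaturatingForce g) :
    ∃ K : ℝ≥0, LipschitzWith K g :=
  exists_lipschitzWith_of_concaveOn_of_convexOn (hg.contDiff.of_le (by norm_num))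
    hg.strictMono.monotone hg.strictConcaveOn_pos.concaveOn hg.strictConvexOn_neg.convexOn

lemma exists_bound_of_periodic (hT : T ≠ 0) (hp : Continuous p) (hper : Function.Periodic p T) :
    ∃ M, ∀ t, |p t| ≤ M := by
  obtain ⟨M, hM⟩ := (hper.isBounded_of_continuous hT hp).exists_norm_le
  exact ⟨M, fun t => hM _ (mem_range_self t)⟩

lemma exists_abs_integral_sub_mean_mul_le (hT : T ≠ 0) (hp : Continuous p)
    (hper : Function.Periodic p T) :
    ∃ B, ∀ s t, |(∫ r in s..t, p r) - ((1 / T) * ∫ r in (0 : ℝ)..T, p r) * (t - s)| ≤ B := by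
  set m := (1 / T) * ∫ r in (0 : ℝ)..T, p r with hm
  have hint : ∀ a b, IntervalIntegrable p volume a b := hp.intervalIntegrable
  set F : ℝ → ℝ := fun s => (∫ r in (0 : ℝ)..s, p r) - m * s with hF
  have hFcont : Continuous F := by
    have := intervalIntegral.continuous_primitive hint 0
    fun_prop
  have hFper : Function.Periodic F T := fun s => by
    have hperiod := hper.intervalIntegral_add_eq s 0
    rw [zero_add] at hperiod
    have hmT : m * T = ∫ r in (0 : ℝ)..T, p r := by rw [hm]; field_simp
    simp only [hF]
    rw [← intervalIntegral.integral_add_adjacent_intervals (hint 0 s) (hint s (s + T)), hperiod,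
      mul_add, hmT]
    ring
  obtain ⟨C, hC⟩ := exists_bound_of_periodic hT hFcont hFper
  refine ⟨C + C, fun s t => ?_⟩
  have hsub : (∫ r in s..t, p r) - m * (t - s) = F t - F s := by
    simp only [hF]
    rw [← intervalIntegral.integral_interval_sub_left (hint 0 t) (hint 0 s)]
    ring
  rw [hsub]
  exact (abs_sub _ _).trans (add_le_add (hC _) (hC _))

theorem exists_twoSidedForce (hlip : LipschitzWith K g) (hmono : Monotone g)
    (hconc : ConcaveOn ℝ (Ioi 0) g) (hconv : ConvexOn ℝ (Iio 0) g)
    (hgminus : Tendsto g atBot (𝓝 gminus)) (hgplus : Tendsto g atTop (𝓝 gplus))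
    (hp : Continuous p) (hT : T ≠ 0) (hper : Function.Periodic p T)
    (hminus : gminus < (1 / T) * ∫ t in (0 : ℝ)..T, p t)
    (hplus : (1 / T) * ∫ t in (0 : ℝ)..T, p t < gplus) :
    ∃ M B, TwoSidedForce g p ((1 / T) * ∫ t in (0 : ℝ)..T, p t) gplus (-gminus) M B K := by
  have hbound : ∀ s, |g s| ≤ max |gminus| |gplus| := fun s =>
    abs_le_max_abs_abs (hmono.le_of_tendsto hgminus s) (hmono.ge_of_tendsto hgplus s)
  obtain ⟨M, hM⟩ := exists_bound_of_periodic hT hp hper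
  obtain ⟨B, hB⟩ := exists_abs_integral_sub_mean_mul_le hT hp hper
  refine ⟨max (max |gminus| |gplus|) M, B, ?_, ?_⟩
  · exact
      { lip := hlip
        bound := fun s => (hbound s).trans (le_max_left _ _)
        mono := hmono
        lim := hgplus
        concave := hconc
        cont := hp
        bound_p := fun t => (hM t).trans (le_max_right _ _)
        mean := hB
        gap := hplus }
  · exact
      { lip := by simpa only [one_mul, mul_one] using! (hlip.comp LipschitzWith.id.neg).neg
        bound := fun s => (abs_neg (g (-s))).trans_le ((hbound _).trans (le_max_left _ _))
        mono := fun _ _ hxy => neg_le_neg (hmono (neg_le_neg hxy))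
        lim := (hgminus.comp tendsto_neg_atTop_atBot).neg
        concave := concaveOn_neg_comp_neg hconv
        cont := hp.neg
        bound_p := fun t => (abs_neg (p t)).trans_le ((hM t).trans (le_max_right _ _))
        mean := fun s t => by
          rw [intervalIntegral.integral_neg, neg_mul, ← neg_sub', abs_neg]
          exact hB s t
        gap := neg_lt_neg hminus }

end StandingAssumptions

/-- The zeros of `u` in `[a, b)`: half-open intervals make the number of zeros additive, and over
a period independent of the starting point. -/
def zerosIco (u : ℝ → ℝ) (a b : ℝ) : Set ℝ := {t | t ∈ Ico a b ∧ u t = 0}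

section Zeros

variable {u : ℝ → ℝ} {a b c τ : ℝ}

lemma encard_zerosIco_add (hab : a ≤ b) (hbc : b ≤ c) :
    (zerosIco u a b).encard + (zerosIco u b c).encard = (zerosIco u a c).encard := by
  rw [← encard_union_eq (disjoint_left.2 fun t ht ht' => ht.1.2.not_ge ht'.1.1)]
  congr 1
  ext t
  simp only [zerosIco, mem_union, mem_ofPred_eq, ← or_and_right, ← Ico_union_Ico_eq_Ico hab hbc]

lemma encard_zerosIco_le (hτ : 0 < τ) (hu : Function.Periodic u τ) (a b : ℝ) :
    (zerosIco u a (a + τ)).encard ≤ (zerosIco u b (b + τ)).encard := by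
  refine encard_le_encard_of_injOn (f := toIcoMod hτ b) (fun t ht => ?_) fun s hs t ht hst => ?_
  · exact ⟨toIcoMod_mem_Ico hτ b t, by rw [toIcoMod, hu.sub_zsmul_eq, ht.2]⟩
  · rw [← (toIcoMod_eq_self hτ).2 hs.1, ← (toIcoMod_eq_self hτ).2 ht.1, toIcoMod_eq_toIcoMod]
    exact (toIcoMod_eq_toIcoMod hτ).1 hst

lemma encard_zerosIco_eq (hτ : 0 < τ) (hu : Function.Periodic u τ) (a b : ℝ) :
    (zerosIco u a (a + τ)).encard = (zerosIco u b (b + τ)).encard :=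
  (encard_zerosIco_le hτ hu a b).antisymm (encard_zerosIco_le hτ hu b a)

lemma encard_zerosIco_nat_mul (hτ : 0 < τ) (hu : Function.Periodic u τ) (a : ℝ) (e : ℕ) :
    (zerosIco u a (a + e * τ)).encard = e * (zerosIco u a (a + τ)).encard := by
  induction e with
  | zero => simp [zerosIco]
  | succ e ih =>
    have hsucc : a + (e + 1 : ℕ) * τ = a + e * τ + τ := by push_cast; ring
    rw [hsucc, ← encard_zerosIco_add (le_add_of_nonneg_right (by positivity))
      (le_add_of_nonneg_right hτ.le), ih, encard_zerosIco_eq hτ hu (a + e * τ) a]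
    push_cast
    ring

lemma encard_zerosIoo_add_one (hab : a < b) (ha : u a = 0) :
    {t | t ∈ Ioo a b ∧ u t = 0}.encard + 1 = (zerosIco u a b).encard := by
  rw [← encard_insert_of_notMem fun h => lt_irrefl a h.1.1]
  congr 1
  ext t
  simp only [zerosIco, ← Ioo_insert_left hab, mem_insert_iff, mem_ofPred_eq, or_and_right]
  exact or_congr_left ⟨fun h => ⟨h, h ▸ ha⟩, And.left⟩

lemma encard_zerosIco_of_partition {t : ℕ → ℝ} {N : ℕ}
    (ht : ∀ i < N, t i < t (i + 1) ∧ u (t i) = 0 ∧ ∀ s ∈ Ioo (t i) (t (i + 1)), u s ≠ 0) :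
    t 0 ≤ t N ∧ (zerosIco u (t 0) (t N)).encard = N := by
  induction N with
  | zero => simp [zerosIco]
  | succ N ih =>
    obtain ⟨hle, hcard⟩ := ih fun i hi => ht i (by omega)
    obtain ⟨hlt, hzero, hne⟩ := ht N N.lt_succ_self
    have hlast : {s | s ∈ Ioo (t N) (t (N + 1)) ∧ u s = 0} = ∅ :=
      eq_empty_of_forall_notMem fun s hs => hne s hs.1 hs.2
    refine ⟨hle.trans hlt.le, ?_⟩
    rw [← encard_zerosIco_add hle hlt.le, hcard, ← encard_zerosIoo_add_one hlt hzero, hlast,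
      encard_empty, zero_add, Nat.cast_succ]

lemma le_period_of_encard_zerosIco_lt {N : ℕ} (hua : u a = 0)
    (hcard : (zerosIco u a (a + τ)).encard < N) {σ : ℝ} (hσ : 0 < σ)
    (hu : Function.Periodic u σ) : τ / N ≤ σ := by
  by_contra! hlt
  have hN : (0 : ℝ) < N := by
    have : (0 : ℕ∞) < N := zero_le.trans_lt hcard
    exact_mod_cast this
  have hNσ : N * σ ≤ τ := by
    rw [lt_div_iff₀ hN] at hlt
    linarith
  have hone : 1 ≤ (zerosIco u a (a + σ)).encard :=
    one_le_encard_iff_nonempty.2 ⟨a, ⟨le_rfl, by linarith⟩, hua⟩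
  refine hcard.not_ge ?_
  calc (N : ℕ∞) = N * 1 := (mul_one _).symm
    _ ≤ N * (zerosIco u a (a + σ)).encard := by gcongr
    _ = (zerosIco u a (a + N * σ)).encard := (encard_zerosIco_nat_mul hσ hu a N).symm
    _ ≤ (zerosIco u a (a + τ)).encard :=
      encard_le_encard fun t ht => ⟨⟨ht.1.1, ht.1.2.trans_le (by linarith)⟩, ht.2⟩

lemma dvd_of_natCast_mul_eq {e N : ℕ} {x : ℕ∞} (h : e * x = N) : e ∣ N := by
  induction x with
  | top =>
    rcases eq_or_ne e 0 with rfl | he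
    · exact zero_dvd_iff.2 (by simpa [eq_comm] using h)
    · rw [ENat.mul_top (Nat.cast_ne_zero.2 he)] at h
      exact absurd h.symm (ENat.natCast_ne_top N)
  | coe z => exact ⟨z, by exact_mod_cast h.symm⟩

end Zeros

section MinimalPeriod

variable {f : ℝ → ℝ} {σ τ T : ℝ}

lemma IsMinimalPeriod.eq (h : IsMinimalPeriod f σ) (h' : IsMinimalPeriod f τ) : σ = τ :=
  le_antisymm (h.2.2 τ h'.1 h'.2.1) (h'.2.2 σ h.1 h.2.1)

lemma IsMinimalPeriod.exists_nat_mul (h : IsMinimalPeriod f T) (hσ : 0 < σ)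
    (hf : Function.Periodic f σ) : ∃ j : ℕ, 0 < j ∧ σ = j * T := by
  have hmem := toIcoMod_mem_Ico h.1 0 σ
  rw [zero_add] at hmem
  have hper : Function.Periodic f (toIcoMod h.1 0 σ) := hf.sub_period (h.2.1.zsmul _)
  have hzero : toIcoMod h.1 0 σ = 0 := by
    by_contra hne
    exact (h.2.2 _ (hmem.1.lt_of_ne' hne) hper).not_gt hmem.2
  have hσT := toIcoMod_add_toIcoDiv_zsmul h.1 0 σ
  rw [hzero, zero_add, zsmul_eq_mul] at hσT
  have hpos : 0 < toIcoDiv h.1 0 σ := by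
    rw [← hσT] at hσ
    exact_mod_cast pos_of_mul_pos_left hσ h.1.le
  lift toIcoDiv h.1 0 σ to ℕ using hpos.le with j
  exact ⟨j, by exact_mod_cast hpos, by exact_mod_cast hσT.symm⟩

lemma exists_isMinimalPeriod_of_forall_le (hf : Continuous f) {ρ : ℝ} (hρ : 0 < ρ) (hτ : 0 < τ)
    (hfτ : Function.Periodic f τ) (hlow : ∀ σ, 0 < σ → Function.Periodic f σ → ρ ≤ σ) :
    ∃ σ, ρ ≤ σ ∧ IsMinimalPeriod f σ := by
  set P : Set ℝ := Ici ρ ∩ ⋂ x, {σ | f (x + σ) = f x}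
  have hmem : ∀ {σ}, σ ∈ P ↔ ρ ≤ σ ∧ Function.Periodic f σ := by
    simp [P, Function.Periodic]
  have hclosed : IsClosed P :=
    isClosed_Ici.inter (isClosed_iInter fun x => isClosed_eq (by fun_prop) continuous_const)
  have hbdd : BddBelow P := ⟨ρ, fun σ hσ => hσ.1⟩
  obtain ⟨hle, hper⟩ := hmem.1 (hclosed.csInf_mem ⟨τ, hmem.2 ⟨hlow τ hτ hfτ, hfτ⟩⟩ hbdd)
  exact ⟨sInf P, hle, hρ.trans_le hle, hper,
    fun σ hσ hfσ => csInf_le hbdd (hmem.2 ⟨hlow σ hσ hfσ, hfσ⟩)⟩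

lemma periodic_gcd_mul {j n : ℕ} (hj : Function.Periodic f (j * T))
    (hn : Function.Periodic f (n * T)) : Function.Periodic f (Nat.gcd j n * T) := by
  have hbezout : (Nat.gcd j n : ℝ) * T =
      (Nat.gcdA j n : ℝ) * (j * T) + (Nat.gcdB j n : ℝ) * (n * T) := by
    have := congrArg (Int.cast : ℤ → ℝ) (Nat.gcd_eq_gcd_ab j n)
    push_cast at this
    rw [this]
    ring
  rw [hbezout]
  exact (hj.int_mul _).add_period (hn.int_mul _)

-- A period `j T` of `f` gives the period `gcd j n * T`, so `n / gcd j n` divides both `n` and the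
-- number `N` of zeros in `[0, n T)`.
lemma isMinimalPeriod_of_coprime {n N : ℕ} (hT : 0 < T) (hn : 0 < n)
    (hf : Function.Periodic f (n * T))
    (hmul : ∀ σ, 0 < σ → Function.Periodic f σ → ∃ j : ℕ, 0 < j ∧ σ = j * T)
    (hcard : (zerosIco f 0 (0 + n * T)).encard = N) (hcop : Nat.Coprime n N) :
    IsMinimalPeriod f (n * T) := by
  refine ⟨by positivity, hf, fun σ hσ hfσ => ?_⟩
  obtain ⟨j, hj, rfl⟩ := hmul σ hσ hfσ
  obtain ⟨e, he⟩ := Nat.gcd_dvd_right j n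
  have hgcd : 0 < (Nat.gcd j n : ℝ) * T :=
    mul_pos (Nat.cast_pos.2 (Nat.gcd_pos_of_pos_left n hj)) hT
  have hdvd : e ∣ N := by
    have hnT : (n : ℝ) * T = e * (Nat.gcd j n * T) := by
      rw [← mul_assoc, ← Nat.cast_mul, mul_comm e, ← he]
    rw [hnT, encard_zerosIco_nat_mul hgcd (periodic_gcd_mul hfσ hf)] at hcard
    exact dvd_of_natCast_mul_eq hcard
  have hgcd_eq : Nat.gcd j n = n := by
    conv_rhs => rw [he, Nat.eq_one_of_dvd_coprimes hcop (Dvd.intro_left _ he.symm) hdvd, mul_one]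
  have hnj : n ≤ j := Nat.le_of_dvd hj (hgcd_eq ▸ Nat.gcd_dvd_left j n)
  gcongr

end MinimalPeriod

section Subharmonics

variable {g p u v : ℝ → ℝ} {T : ℝ} {n N k : ℕ}

lemma isSolution_of_hasDerivAt (hg : Continuous g) (hp : Continuous p)
    (hu : ∀ s, HasDerivAt u (v s) s) (hv : ∀ s, HasDerivAt v (p s - g (u s)) s) :
    IsSolution g p u := by
  have hdu : deriv u = v := funext fun s => (hu s).deriv
  have hdv : deriv v = fun s => p s - g (u s) := funext fun s => (hv s).deriv
  have hud : Differentiable ℝ u := fun s => (hu s).differentiableAt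
  have hvd : Differentiable ℝ v := fun s => (hv s).differentiableAt
  refine ⟨?_, fun t => by rw [hdu, hdv, sub_add_cancel]⟩
  have huc := hud.continuous
  rw [← one_add_one_eq_two, contDiff_succ_iff_deriv, hdu, contDiff_one_iff_deriv, hdv]
  exact ⟨hud, by simp, hvd, by fun_prop⟩

lemma IsSolution.periodic_forcing (hu : IsSolution g p u) {σ : ℝ} (hσ : Function.Periodic u σ) :
    Function.Periodic p σ := by
  have hderiv : ∀ {f : ℝ → ℝ}, Function.Periodic f σ → Function.Periodic (deriv f) σ :=
    fun {f} hf s => by rw [← deriv_comp_add_const, funext hf]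
  intro s
  rw [← hu.2, ← hu.2, hderiv (hderiv hσ) s, hσ s]

/-- `u` is an `nT`-periodic solution with exactly `N` zeros per period: a subharmonic of order `n`
when the forcing `p` has period `T`. -/
structure IsSubharmonic (g p : ℝ → ℝ) (T : ℝ) (n N : ℕ) (u : ℝ → ℝ) : Prop where
  isSolution : IsSolution g p u
  periodic : Function.Periodic u (n * T)
  encard_zerosIco : ∀ a, (zerosIco u a (a + n * T)).encard = N

namespace IsSubharmonic

lemma exists_zero (hu : IsSubharmonic g p T n (k + 1) u) : ∃ t₀, u t₀ = 0 := by
  have hcard := hu.encard_zerosIco 0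
  obtain ⟨t, ht⟩ := one_le_encard_iff_nonempty.1 (by rw [hcard]; simp)
  exact ⟨t, ht.2⟩

lemma exists_encard_zerosIoo (hu : IsSubharmonic g p T n (k + 1) u) (hnT : 0 < n * T) :
    ∃ t₀, u t₀ = 0 ∧ {t | t ∈ Ioo t₀ (t₀ + n * T) ∧ u t = 0}.encard = k := by
  obtain ⟨t₀, ht₀⟩ := hu.exists_zero
  refine ⟨t₀, ht₀, ?_⟩
  have hcard := encard_zerosIoo_add_one (lt_add_of_pos_right t₀ hnT) ht₀
  rw [hu.encard_zerosIco, Nat.cast_succ] at hcard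
  exact (ENat.addLECancellable_of_ne_top ENat.one_ne_top).inj_left.1 hcard

lemma isMinimalPeriod (hu : IsSubharmonic g p T n N u) (hn : 0 < n) (hT : IsMinimalPeriod p T)
    (hcop : Nat.Coprime n N) : IsMinimalPeriod u (n * T) :=
  isMinimalPeriod_of_coprime hT.1 hn hu.periodic
    (fun _ hσ huσ => hT.exists_nat_mul hσ (hu.isSolution.periodic_forcing huσ))
    (hu.encard_zerosIco 0) hcop

lemma exists_isMinimalPeriod (hu : IsSubharmonic g p T n (k + 1) u) (hnT : 0 < n * T) :
    ∃ τ, n * T / (k + 2 : ℕ) ≤ τ ∧ IsMinimalPeriod u τ := by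
  obtain ⟨t₀, ht₀⟩ := hu.exists_zero
  refine exists_isMinimalPeriod_of_forall_le hu.isSolution.1.continuous (by positivity) hnT
    hu.periodic fun σ hσ huσ => le_period_of_encard_zerosIco_lt ht₀ ?_ hσ huσ
  rw [hu.encard_zerosIco]
  exact_mod_cast Nat.lt_succ_self (k + 1)

end IsSubharmonic

theorem TwoSidedForce.exists_isSubharmonic {m G G' M B T₀ : ℝ} {K : ℝ≥0}
    (hf : TwoSidedForce g p m G G' M B K) (hT₀ : 0 < T₀) (hper : Function.Periodic p T₀) :
    ∃ H : ℝ, 0 < H ∧ ∀ T, Function.Periodic p T → ∀ k n : ℕ, Odd k → H * (k + 1) ≤ n * T →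
      ∃ u, IsSubharmonic g p T n (k + 1) u := by
  obtain ⟨H, hH, hsol⟩ := hf.exists_periodic_solution hT₀ hper
  refine ⟨H, hH, fun T hT k n hk hkn => ?_⟩
  obtain ⟨u, v, t, hu, hv, huper, hlast, ht⟩ := hsol (n * T) (hT.nat_mul n) k hk hkn
  have hnT : 0 < n * T := hkn.trans_lt' (by positivity)
  refine ⟨u, isSolution_of_hasDerivAt hf.pos.continuous_g hf.pos.cont hu hv, huper, fun a => ?_⟩
  rw [encard_zerosIco_eq hnT huper a (t 0), ← hlast]
  exact (encard_zerosIco_of_partition ht).2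

-- Odd orders are coprime to the number of zeros per period, two, and two zeros per period bound
-- the minimal period below by a third of the period.
lemma exists_seq_isMinimalPeriod {L : ℝ} (hT : 0 < T)
    (hsub : ∀ n : ℕ, L ≤ n * T → ∃ u, IsSubharmonic g p T n 2 u) :
    ∃ (u : ℕ → ℝ → ℝ) (N : ℕ → ℕ) (τ : ℕ → ℝ), StrictMono N ∧ Tendsto τ atTop atTop ∧
      ∀ j, IsSolution g p (u j) ∧ Function.Periodic (u j) (N j * T) ∧
        IsMinimalPeriod (u j) (τ j) ∧ (IsMinimalPeriod p T → τ j = N j * T) := by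
  obtain ⟨n₀, hn₀⟩ := exists_nat_gt (L / T)
  rw [div_lt_iff₀ hT] at hn₀
  set N : ℕ → ℕ := fun j => 2 * (j + n₀) + 1
  have hN : StrictMono N := strictMono_nat_of_lt_succ fun j => by simp only [N]; omega
  have hNT : ∀ j, 0 < N j * T := fun j => by positivity
  choose u hu using fun j => hsub (N j) <| hn₀.le.trans <|
    mul_le_mul_of_nonneg_right (Nat.cast_le.2 (by simp only [N]; omega)) hT.le
  choose τ hle hτ using fun j => (hu j).exists_isMinimalPeriod (hNT j)
  refine ⟨u, N, τ, hN, tendsto_atTop_mono hle ?_, fun j =>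
    ⟨(hu j).isSolution, (hu j).periodic, hτ j, fun hmin => (hτ j).eq <|
      (hu j).isMinimalPeriod (by simp only [N]; omega) hmin
        (Nat.coprime_two_right.2 ⟨j + n₀, rfl⟩)⟩⟩
  exact ((tendsto_natCast_atTop_atTop.comp hN.tendsto_atTop).atTop_mul_const hT).atTop_div_const
    (by positivity)

end Subharmonics

theorem theorem7_general (g p : ℝ → ℝ) (gminus gplus : ℝ) {K : ℝ≥0}
    (hlip : LipschitzWith K g) (hmono : Monotone g)
    (hconc : ConcaveOn ℝ (Ioi 0) g) (hconv : ConvexOn ℝ (Iio 0) g)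
    (hgminus : Tendsto g atBot (𝓝 gminus)) (hgplus : Tendsto g atTop (𝓝 gplus))
    (hp : Continuous p) :
    ∃ H : ℝ, 0 < H ∧
      ∀ T : ℝ, 0 < T → Function.Periodic p T →
        gminus < (1 / T) * ∫ t in (0 : ℝ)..T, p t →
        (1 / T) * ∫ t in (0 : ℝ)..T, p t < gplus →
        (∀ k n : ℕ, Odd k → H * ((k : ℝ) + 1) ≤ (n : ℝ) * T →
          ∃ u : ℝ → ℝ, IsSolution g p u ∧ Function.Periodic u ((n : ℝ) * T) ∧
            (∃ t₀ : ℝ, u t₀ = 0 ∧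
              {t : ℝ | t ∈ Ioo t₀ (t₀ + (n : ℝ) * T) ∧ u t = 0}.encard = (k : ℕ∞)) ∧
            (∀ a : ℝ,
              {t : ℝ | t ∈ Ico a (a + (n : ℝ) * T) ∧ u t = 0}.encard = (k : ℕ∞) + 1) ∧
            (IsMinimalPeriod p T → Nat.Coprime n (k + 1) →
              IsMinimalPeriod u ((n : ℝ) * T))) ∧
        (∃ (u : ℕ → ℝ → ℝ) (N : ℕ → ℕ) (τ : ℕ → ℝ), StrictMono N ∧ Tendsto τ atTop atTop ∧
          ∀ j : ℕ, IsSolution g p (u j) ∧ Function.Periodic (u j) ((N j : ℝ) * T) ∧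
            IsMinimalPeriod (u j) (τ j) ∧
            (IsMinimalPeriod p T → τ j = (N j : ℝ) * T)) := by
  by_cases hex : ∃ T₀ : ℝ, 0 < T₀ ∧ Function.Periodic p T₀ ∧
      gminus < (1 / T₀) * ∫ t in (0 : ℝ)..T₀, p t ∧ (1 / T₀) * ∫ t in (0 : ℝ)..T₀, p t < gplus
  swap
  · exact ⟨1, one_pos, fun T hT hper h h' => absurd ⟨T, hT, hper, h, h'⟩ hex⟩
  obtain ⟨T₀, hT₀, hper₀, hminus, hplus⟩ := hex
  obtain ⟨M, B, hf⟩ := exists_twoSidedForce hlip hmono hconc hconv hgminus hgplus hp hT₀.ne' hper₀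
    hminus hplus
  obtain ⟨H, hH, hsub⟩ := hf.exists_isSubharmonic hT₀ hper₀
  refine ⟨H, hH, fun T hT hper _ _ => ⟨fun k n hk hkn => ?_, ?_⟩⟩
  · obtain ⟨u, hu⟩ := hsub T hper k n hk hkn
    have hnT : 0 < n * T := hkn.trans_lt' (by positivity)
    have hn : 0 < n := Nat.cast_pos.1 (pos_of_mul_pos_left hnT hT.le)
    exact ⟨u, hu.isSolution, hu.periodic, hu.exists_encard_zerosIoo hnT, hu.encard_zerosIco,
      hu.isMinimalPeriod hn⟩
  · exact exists_seq_isMinimalPeriod hT fun n hn => hsub T hper 1 n odd_one hn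

theorem theorem7 (g p : ℝ → ℝ) (gminus gplus : ℝ)
    (hg : IsSaturatingForce g)
    (hgminus : Filter.Tendsto g Filter.atBot (nhds gminus))
    (hgplus : Filter.Tendsto g Filter.atTop (nhds gplus))
    (hp : Continuous p) :
    ∃ H : ℝ, 0 < H ∧
      ∀ T : ℝ, 0 < T → Function.Periodic p T →
        gminus < (1 / T) * ∫ t in (0 : ℝ)..T, p t →
        (1 / T) * ∫ t in (0 : ℝ)..T, p t < gplus →
        (∀ k n : ℕ, Odd k → H * ((k : ℝ) + 1) ≤ (n : ℝ) * T →
          ∃ u : ℝ → ℝ, IsSolution g p u ∧ Function.Periodic u ((n : ℝ) * T) ∧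
            (∃ t₀ : ℝ, u t₀ = 0 ∧
              {t : ℝ | t ∈ Set.Ioo t₀ (t₀ + (n : ℝ) * T) ∧ u t = 0}.encard = (k : ℕ∞)) ∧
            (∀ a : ℝ,
              {t : ℝ | t ∈ Set.Ico a (a + (n : ℝ) * T) ∧ u t = 0}.encard = (k : ℕ∞) + 1) ∧
            (IsMinimalPeriod p T → Nat.Coprime n (k + 1) →
              IsMinimalPeriod u ((n : ℝ) * T))) ∧
        (∃ (u : ℕ → ℝ → ℝ) (N : ℕ → ℕ) (τ : ℕ → ℝ), StrictMono N ∧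
          Filter.Tendsto τ Filter.atTop Filter.atTop ∧
          ∀ j : ℕ, IsSolution g p (u j) ∧ Function.Periodic (u j) ((N j : ℝ) * T) ∧
            IsMinimalPeriod (u j) (τ j) ∧
            (IsMinimalPeriod p T → τ j = (N j : ℝ) * T)) := by
  obtain ⟨K, hlip⟩ := hg.exists_lipschitzWith
  exact theorem7_general g p gminus gplus hlip hg.strictMono.monotone
    hg.strictConcaveOn_pos.concaveOn hg.strictConvexOn_neg.convexOn hgminus hgplus hp
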